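/- Let $k$ be a field and $H$ a Hopf algebra over $k$ with coproduct $\Delta(x)=\sum x_1\otimes x_2$ and counit $\varepsilon$. **Lazy cohomology.** For a coalgebra $C$ let $\mathrm{Reg}(C)$ be the group of linear forms on $C$ that are invertible for the convolution product $(\lambda\mu)(x)=\sum\lambda(x_1)\mu(x_2)$. Let $\mathrm{Reg}^1_\ell(H)$ be the group of all $\lambda\in\mathrm{Reg}(H)$ with $\sum\lambda(x_1)x_2=\sum\lambda(x_2)x_1$ for all $x\in H$. Let $Z^2_\ell(H)$ be the group of all $\sigma\in\mathrm{Reg}(H\otimes H)$ such that, for all $x,y,z\in H$, $$\sum\sigma(x_1\otimes y_1)\,x_2y_2=\sum\sigma(x_2\otimes y_2)\,x_1y_1,\qquad \sum\sigma(x_1\otimes y_1)\,\sigma(x_2y_2\otimes z)=\sum\sigma(y_1\otimes z_1)\,\sigma(x\otimes y_2z_2).$$ Let $B^2_\ell(H)$ be its central subgroup of all $\partial\lambda$ with $\lambda\in\mathrm{Reg}^1_\ell(H)$, where $\partial\lambda(x\otimes y)=\sum\lambda(x_1)\lambda(y_1)\lambda^{-1}(x_2y_2)$. The second lazy cohomology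 group of $H$ is $H^2_\ell(H)=Z^2_\ell(H)/B^2_\ell(H)$. **Twist cohomology.** Let $Z^2(H)$ be the group of invertible $F\in H\otimes H$ such that $\Delta(a)F=F\Delta(a)$ for all $a\in H$ and $(F\otimes1)(\Delta\otimes\mathrm{id})(F)=(1\otimes F)(\mathrm{id}\otimes\Delta)(F)$. The second twist cohomology group $H^2_{\mathrm{tw}}(H)$ is the quotient of $Z^2(H)$ by its central subgroup of all $(a\otimes a)\Delta(a^{-1})$, where $a$ runs over the central units of $H$. For a finite group $G$ let $\mathcal O_k(G)$ be the finite-dimensional Hopf algebra of $k$-valued functions on $G$; on the characteristic functions $e_g$ of the singletons $\{g\}$ its coproduct is $\Delta(e_g)=\sum_{h\in G}e_h\otimes e_{h^{-1}g}$. Let $\mathrm{Aut}_c(G)$ be the group of automorphisms of $G$ that map every element to a conjugate of itself, and $\mathrm{Inn}(G)$ the group of inner automorphisms. **Statement.** For every prime $p$ and every integer $m\ge3$ there is a group $G$ of order $p^{5m}$ such that $\mathrm{Aut}_c(G)/\mathrm{Inn}(G)$ is non-abelian and such that, for every algebraically closed field $k$ whose characteristic is not $p$, the lazy cohomology group $H^2_\ell(\mathcal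 O_k(G))$ of the finite-dimensional Hopf algebra $\mathcal O_k(G)$ and the twist cohomology group $H^2_{\mathrm{tw}}(k[G])$ of the group algebra $k[G]$ are both non-abelian. In particular there are finite-dimensional Hopf algebras $H$ for which $H^2_\ell(H)$ is not abelian, and finite-dimensional Hopf algebras $H$ for which $H^2_{\mathrm{tw}}(H)$ is not abelian. -/

import Mathlib

open scoped TensorProduct
open WithConv

universe u v w

namespace LazyCoh

section Convolution

variable (k : Type u) [Field k]

/-- `Reg(C)`: the group of convolution-invertible linear forms on a coalgebra `C`
(product `(l m)(x) = ∑ l(x₁) m(x₂)`, unit the counit). -/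
abbrev Reg (C : Type v) [AddCommMonoid C] [Module k C] [Coalgebra k C] : Type (max u v) :=
  (WithConv (C →ₗ[k] k))ˣ

variable {k}
variable {C D E : Type*} [AddCommMonoid C] [Module k C] [Coalgebra k C]
  [AddCommMonoid D] [Module k D] [Coalgebra k D] [AddCommMonoid E] [Module k E] [Coalgebra k E]
variable {A B : Type*} [Semiring A] [Algebra k A] [Semiring B] [Algebra k B]

/-- Precomposition with a coalgebra map, as a map of convolution groups. -/
noncomputable def pull (f : C →ₗc[k] D) : Reg k D →* Reg k C :=
  Units.map
    { toFun := fun l => toConv (l.ofConv ∘ₗ (f : C →ₗ[k] D))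
      map_one' := by
        ext x
        simp [LinearMap.convOne_def]
      map_mul' := fun l m => by
        have := LinearMap.convMul_comp_coalgHom_distrib l m f
        exact WithConv.ext this }

theorem pull_apply (f : C →ₗc[k] D) (l : Reg k D) (x : C) :
    (pull f l : WithConv (C →ₗ[k] k)) x = (l : WithConv (D →ₗ[k] k)) (f x) := rfl

theorem pull_pull (f : C →ₗc[k] D) (g : D →ₗc[k] E) (l : Reg k E) :
    pull f (pull g l) = pull (g.comp f) l := rfl

/-- A linear form `l : C → k` viewed as the linear map `x ↦ l(x) 1` with values in an algebra `A`. -/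
noncomputable def scalarMap (A : Type*) [Semiring A] [Algebra k A] :
    WithConv (C →ₗ[k] k) →* WithConv (C →ₗ[k] A) where
  toFun l := toConv (Algebra.linearMap k A ∘ₗ l.ofConv)
  map_one' := by ext x; simp [LinearMap.convOne_def]
  map_mul' l m := by
    have := LinearMap.algHom_comp_convMul_distrib (Algebra.ofId k A) l m
    exact WithConv.ext this

theorem scalarMap_mul_apply (l : WithConv (C →ₗ[k] k)) (f : C →ₗ[k] A) {x : C} {ι : Type*}
    (r : Coalgebra.Repr k x ι) :
    (scalarMap A l * toConv f).ofConv x = ∑ i ∈ r.index, l (r.left i) • f (r.right i) := by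
  refine (r.convMul_apply _ _).trans ?_
  refine Finset.sum_congr rfl fun i _ => ?_
  rw [Algebra.smul_def]; rfl

theorem mul_scalarMap_apply (l : WithConv (C →ₗ[k] k)) (f : C →ₗ[k] A) {x : C} {ι : Type*}
    (r : Coalgebra.Repr k x ι) :
    (toConv f * scalarMap A l).ofConv x = ∑ i ∈ r.index, l (r.right i) • f (r.left i) := by
  refine (r.convMul_apply _ _).trans ?_
  refine Finset.sum_congr rfl fun i _ => ?_
  rw [Algebra.smul_def, Algebra.commutes]; rfl

/-- The convolution-invertible forms `l` on `C` with `∑ l(x₁) f(x₂) = ∑ l(x₂) f(x₁)` for all `x`,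
for a given linear map `f : C → A`; the equation is an identity of convolution products. -/
def lazyWith (f : C →ₗ[k] A) : Subgroup (Reg k C) where
  carrier := {l | scalarMap A (l : WithConv (C →ₗ[k] k)) * toConv f = toConv f * scalarMap A l}
  one_mem' := by simp
  mul_mem' {l m} hl hm := by
    have hl' : Commute (scalarMap A (l : WithConv (C →ₗ[k] k))) (toConv f) := hl
    have hm' : Commute (scalarMap A (m : WithConv (C →ₗ[k] k))) (toConv f) := hm
    have : Commute (scalarMap A ((l * m : Reg k C) : WithConv (C →ₗ[k] k))) (toConv f) := by
      rw [Units.val_mul, map_mul]; exact hl'.mul_left hm'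
    exact this
  inv_mem' {l} hl := by
    have hl' : Commute ((Units.map (scalarMap A) l : (WithConv (C →ₗ[k] A))ˣ) :
      WithConv (C →ₗ[k] A)) (toConv f) := hl
    have := hl'.units_inv_left
    rw [← map_inv] at this
    exact this

theorem mem_lazyWith_iff (f : C →ₗ[k] A) (l : Reg k C) :
    l ∈ lazyWith f ↔ ∀ x : C,
      (scalarMap A (l : WithConv (C →ₗ[k] k)) * toConv f).ofConv x =
        (toConv f * scalarMap A (l : WithConv (C →ₗ[k] k))).ofConv x := by
  constructor
  · intro h x
    have h' : scalarMap A (l : WithConv (C →ₗ[k] k)) * toConv f = toConv f * scalarMap A l := h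
    rw [h']
  · intro h
    exact WithConv.ext (LinearMap.ext h)

theorem lazyWith_comp {f : C →ₗ[k] A} {l : Reg k C} (h : l ∈ lazyWith f) (g : A →ₗ[k] B) :
    l ∈ lazyWith (g ∘ₗ f) := by
  rw [mem_lazyWith_iff] at h ⊢
  intro x
  have hx := congrArg g (h x)
  rw [scalarMap_mul_apply _ _ (Coalgebra.Repr.arbitrary k x),
    mul_scalarMap_apply _ _ (Coalgebra.Repr.arbitrary k x)] at hx ⊢
  simpa using hx

theorem lazyWith_pull {f : D →ₗ[k] A} {l : Reg k D} (h : l ∈ lazyWith f) (g : C →ₗc[k] D) :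
    pull g l ∈ lazyWith (f ∘ₗ (g : C →ₗ[k] D)) := by
  rw [mem_lazyWith_iff] at h ⊢
  intro x
  have hx := h (g x)
  rw [scalarMap_mul_apply _ _ ((Coalgebra.Repr.arbitrary k x).induced g),
    mul_scalarMap_apply _ _ ((Coalgebra.Repr.arbitrary k x).induced g)] at hx
  rw [scalarMap_mul_apply _ _ (Coalgebra.Repr.arbitrary k x),
    mul_scalarMap_apply _ _ (Coalgebra.Repr.arbitrary k x)]
  exact hx

theorem commute_pull_of_lazyWith {H : Type*} [Semiring H] [Algebra k H] [Coalgebra k H]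
    {g : C →ₗc[k] H} {l : Reg k C}
    (h : l ∈ lazyWith (g : C →ₗ[k] H)) (r : Reg k H) : l * pull g r = pull g r * l := by
  have h1 := lazyWith_comp h (r : WithConv (H →ₗ[k] k)).ofConv
  apply Units.ext
  exact h1

/-- `x ⊗ y ↦ ε(y) x`. -/
noncomputable def pr₁ : C ⊗[k] D →ₗc[k] C :=
  (Coalgebra.TensorProduct.rid k k C).toCoalgHom.comp
    (Coalgebra.TensorProduct.map (CoalgHom.id k C) (Coalgebra.counitCoalgHom k D))

/-- `x ⊗ y ↦ ε(x) y`. -/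
noncomputable def pr₂ : C ⊗[k] D →ₗc[k] D :=
  (Coalgebra.TensorProduct.lid k D).toCoalgHom.comp
    (Coalgebra.TensorProduct.map (Coalgebra.counitCoalgHom k C) (CoalgHom.id k D))

@[simp] theorem pr₁_tmul (x : C) (y : D) :
    (pr₁ : C ⊗[k] D →ₗc[k] C) (x ⊗ₜ y) = Coalgebra.counit (R := k) y • x := rfl

@[simp] theorem pr₂_tmul (x : C) (y : D) :
    (pr₂ : C ⊗[k] D →ₗc[k] D) (x ⊗ₜ y) = Coalgebra.counit (R := k) x • y := rfl

/-- If `Δ(x) = ∑ x₁ ⊗ x₂` and `Δ(y) = ∑ y₁ ⊗ y₂`, then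
`Δ(x ⊗ y) = ∑ (x₁ ⊗ y₁) ⊗ (x₂ ⊗ y₂)`. -/
def tmulRepr {x : C} {y : D} {ι κ : Type*} (r : Coalgebra.Repr k x ι) (s : Coalgebra.Repr k y κ) :
    Coalgebra.Repr k (x ⊗ₜ[k] y) (ι × κ) where
  index := r.index ×ˢ s.index
  left i := r.left i.1 ⊗ₜ s.left i.2
  right i := r.right i.1 ⊗ₜ s.right i.2
  eq := by
    simp [← r.eq, ← s.eq, TensorProduct.sum_tmul r.index, TensorProduct.tmul_sum,
      ← Finset.sum_product']

theorem sum_smul_counit {y : D} {ι : Type*}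
    (s : Coalgebra.Repr k y ι) :
    ∑ i ∈ s.index, Coalgebra.counit (R := k) (s.right i) • s.left i = y := by
  have h := congrArg (TensorProduct.rid k D) (Coalgebra.sum_tmul_counit_eq s)
  rw [map_sum] at h
  simpa only [TensorProduct.rid_tmul, one_smul] using h

theorem pull_pr₁_mem_lazyWith {f : C →ₗ[k] A} {l : Reg k C} (h : l ∈ lazyWith f)
    (g : D →ₗ[k] B) :
    pull pr₁ l ∈ lazyWith
      (TensorProduct.map f g : C ⊗[k] D →ₗ[k] A ⊗[k] B) := by
  rw [mem_lazyWith_iff] at h ⊢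
  intro t
  induction t with
  | zero => simp only [map_zero]
  | add a b ha hb => rw [map_add, map_add, ha, hb]
  | tmul x y =>
    have hx := h x
    have r := Coalgebra.Repr.arbitrary k x
    have s := Coalgebra.Repr.arbitrary k y
    rw [scalarMap_mul_apply _ _ r, mul_scalarMap_apply _ _ r] at hx
    rw [scalarMap_mul_apply _ _ (tmulRepr r s), mul_scalarMap_apply _ _ (tmulRepr r s)]
    trans (∑ i ∈ r.index, (l : WithConv (C →ₗ[k] k)) (r.left i) • f (r.right i)) ⊗ₜ[k] g y
    · conv_rhs => rw [← Coalgebra.sum_counit_smul s, map_sum, TensorProduct.sum_tmul]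
      simp_rw [TensorProduct.tmul_sum]
      refine (Finset.sum_product _ _ _).trans ?_
      refine Finset.sum_congr rfl fun i _ => Finset.sum_congr rfl fun j _ => ?_
      simp [pull_apply, tmulRepr, TensorProduct.smul_tmul', smul_smul]
    · refine (congrArg (fun z : A => z ⊗ₜ[k] g y) hx).trans ?_
      conv_lhs => rw [← sum_smul_counit s, map_sum, TensorProduct.sum_tmul]
      simp_rw [TensorProduct.tmul_sum]
      refine Eq.trans ?_ (Finset.sum_product _ _ _).symm
      refine Finset.sum_congr rfl fun i _ => Finset.sum_congr rfl fun j _ => ?_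
      simp [pull_apply, tmulRepr, TensorProduct.smul_tmul', smul_smul]

theorem pull_pr₂_mem_lazyWith {f : C →ₗ[k] A} {l : Reg k C} (h : l ∈ lazyWith f)
    (g : D →ₗ[k] B) :
    pull pr₂ l ∈ lazyWith
      (TensorProduct.map g f : D ⊗[k] C →ₗ[k] B ⊗[k] A) := by
  rw [mem_lazyWith_iff] at h ⊢
  intro t
  induction t with
  | zero => simp only [map_zero]
  | add a b ha hb => rw [map_add, map_add, ha, hb]
  | tmul y x =>
    have hx := h x
    have r := Coalgebra.Repr.arbitrary k x
    have s := Coalgebra.Repr.arbitrary k y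
    rw [scalarMap_mul_apply _ _ r, mul_scalarMap_apply _ _ r] at hx
    rw [scalarMap_mul_apply _ _ (tmulRepr s r), mul_scalarMap_apply _ _ (tmulRepr s r)]
    trans g y ⊗ₜ[k] (∑ i ∈ r.index, (l : WithConv (C →ₗ[k] k)) (r.left i) • f (r.right i))
    · conv_rhs => rw [← Coalgebra.sum_counit_smul s, map_sum, TensorProduct.sum_tmul]
      simp_rw [TensorProduct.tmul_sum]
      refine (Finset.sum_product _ _ _).trans ?_
      refine Finset.sum_congr rfl fun i _ => Finset.sum_congr rfl fun j _ => ?_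
      simp [pull_apply, tmulRepr, TensorProduct.smul_tmul', smul_smul, mul_comm]
    · refine (congrArg (fun z : A => g y ⊗ₜ[k] z) hx).trans ?_
      conv_lhs => rw [← sum_smul_counit s, map_sum, TensorProduct.sum_tmul]
      simp_rw [TensorProduct.tmul_sum]
      refine Eq.trans ?_ (Finset.sum_product _ _ _).symm
      refine Finset.sum_congr rfl fun i _ => Finset.sum_congr rfl fun j _ => ?_
      simp [pull_apply, tmulRepr, TensorProduct.smul_tmul', smul_smul, mul_comm]

end Convolution

section Lazy

variable (k : Type u) [Field k] (H : Type v) [Ring H] [HopfAlgebra k H]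

/-- The multiplication `H ⊗ H → H`, a coalgebra map. -/
noncomputable abbrev mulC : H ⊗[k] H →ₗc[k] H := Bialgebra.mulCoalgHom k H

/-- `Reg¹_ℓ(H)`: the forms `l ∈ Reg(H)` with `∑ l(x₁) x₂ = ∑ l(x₂) x₁` for all `x`. -/
noncomputable def RegLazy1 : Subgroup (Reg k H) := lazyWith (LinearMap.id : H →ₗ[k] H)

/-- `Reg²_ℓ(H)`: the forms `s ∈ Reg(H ⊗ H)` with
`∑ s(x₁ ⊗ y₁) x₂y₂ = ∑ s(x₂ ⊗ y₂) x₁y₁` for all `x`, `y`. -/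
noncomputable def RegLazy2 : Subgroup (Reg k (H ⊗[k] H)) :=
  lazyWith (LinearMap.mul' k H : H ⊗[k] H →ₗ[k] H)

variable {k H}

/-- `x ⊗ y ⊗ z ↦ ∑ s(x₁ ⊗ y₁) s(x₂y₂ ⊗ z)`, the convolution product of
`x ⊗ y ⊗ z ↦ s(x ⊗ y) ε(z)` and `x ⊗ y ⊗ z ↦ s(xy ⊗ z)`. -/
noncomputable def cocycleL (s : Reg k (H ⊗[k] H)) : Reg k ((H ⊗[k] H) ⊗[k] H) :=
  pull pr₁ s * pull (Coalgebra.TensorProduct.map (mulC k H) (CoalgHom.id k H)) s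

/-- `x ⊗ y ⊗ z ↦ ∑ s(y₁ ⊗ z₁) s(x ⊗ y₂z₂)`, the convolution product of
`x ⊗ y ⊗ z ↦ ε(x) s(y ⊗ z)` and `x ⊗ y ⊗ z ↦ s(x ⊗ yz)`. -/
noncomputable def cocycleR (s : Reg k (H ⊗[k] H)) : Reg k ((H ⊗[k] H) ⊗[k] H) :=
  pull (Coalgebra.TensorProduct.assoc k k H H H).toCoalgHom
    (pull pr₂ s * pull (Coalgebra.TensorProduct.map (CoalgHom.id k H) (mulC k H)) s)

theorem mul_mul_mul_swap {G : Type*} [Group G] {a b c d : G} (h : b * c = c * b) :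
    a * b * (c * d) = a * c * (b * d) := by
  rw [mul_assoc, ← mul_assoc b, h, mul_assoc, mul_assoc]

theorem cocycleL_mul {s t : Reg k (H ⊗[k] H)} (ht : t ∈ RegLazy2 k H) :
    cocycleL (s * t) = cocycleL s * cocycleL t := by
  have h := commute_pull_of_lazyWith (g := Coalgebra.TensorProduct.map (mulC k H) (CoalgHom.id k H))
    (pull_pr₁_mem_lazyWith ht LinearMap.id) s
  simp only [cocycleL, map_mul]
  exact mul_mul_mul_swap h

theorem cocycleR_mul {s t : Reg k (H ⊗[k] H)} (ht : t ∈ RegLazy2 k H) :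
    cocycleR (s * t) = cocycleR s * cocycleR t := by
  have h := commute_pull_of_lazyWith (g := Coalgebra.TensorProduct.map (CoalgHom.id k H) (mulC k H))
    (pull_pr₂_mem_lazyWith ht LinearMap.id) s
  simp only [cocycleR, ← map_mul]
  congr 1
  simp only [map_mul]
  exact mul_mul_mul_swap h

variable (k H) in
/-- `Z²_ℓ(H)`: the group of lazy left 2-cocycles, that is of all `s ∈ Reg²_ℓ(H)` with
`∑ s(x₁ ⊗ y₁) s(x₂y₂ ⊗ z) = ∑ s(y₁ ⊗ z₁) s(x ⊗ y₂z₂)` for all `x`, `y`, `z`. -/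
noncomputable def LazyZ2 : Subgroup (Reg k (H ⊗[k] H)) where
  carrier := {s | s ∈ RegLazy2 k H ∧ cocycleL s = cocycleR s}
  one_mem' := ⟨one_mem _, by simp [cocycleL, cocycleR]⟩
  mul_mem' {s t} hs ht := ⟨mul_mem hs.1 ht.1, by
    rw [cocycleL_mul ht.1, cocycleR_mul ht.1, hs.2, ht.2]⟩
  inv_mem' {s} hs := ⟨inv_mem hs.1, by
    have h1 := cocycleL_mul (s := s⁻¹) hs.1
    have h2 := cocycleR_mul (s := s⁻¹) hs.1
    have e : cocycleL (1 : Reg k (H ⊗[k] H)) = cocycleR 1 := by simp [cocycleL, cocycleR]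
    rw [inv_mul_cancel] at h1 h2
    rw [e, h2, hs.2] at h1
    exact (mul_right_cancel h1).symm⟩

/-- `∂l : x ⊗ y ↦ ∑ l(x₁) l(y₁) l⁻¹(x₂y₂)`, the convolution product of `x ⊗ y ↦ l(x) l(y)`
(written as the product of `x ⊗ y ↦ l(x) ε(y)` and `x ⊗ y ↦ ε(x) l(y)`) and of
`x ⊗ y ↦ l⁻¹(xy)`. -/
noncomputable def coboundary (l : Reg k H) : Reg k (H ⊗[k] H) :=
  pull pr₁ l * pull pr₂ l * pull (mulC k H) l⁻¹

theorem central_of_lazy {A : Type*} [Semiring A] [Algebra k A] [Coalgebra k A] {l : Reg k A}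
    (hl : l ∈ lazyWith (LinearMap.id : A →ₗ[k] A)) (m : Reg k A) : Commute l m :=
  commute_pull_of_lazyWith (g := CoalgHom.id k A) hl m

theorem pr₁_lazy {A B : Type*} [Semiring A] [Algebra k A] [Coalgebra k A] [Semiring B]
    [Algebra k B] [Coalgebra k B] {l : Reg k A} (hl : l ∈ lazyWith (LinearMap.id : A →ₗ[k] A)) :
    pull pr₁ l ∈ lazyWith (LinearMap.id : A ⊗[k] B →ₗ[k] A ⊗[k] B) := by
  have h := pull_pr₁_mem_lazyWith hl (LinearMap.id : B →ₗ[k] B)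
  rwa [TensorProduct.map_id] at h

theorem pr₂_lazy {A B : Type*} [Semiring A] [Algebra k A] [Coalgebra k A] [Semiring B]
    [Algebra k B] [Coalgebra k B] {l : Reg k A} (hl : l ∈ lazyWith (LinearMap.id : A →ₗ[k] A)) :
    pull pr₂ l ∈ lazyWith (LinearMap.id : B ⊗[k] A →ₗ[k] B ⊗[k] A) := by
  have h := pull_pr₂_mem_lazyWith hl (LinearMap.id : B →ₗ[k] B)
  rwa [TensorProduct.map_id] at h

theorem mul_rearrange {G : Type*} [Group G] {a b c a' b' c' : G} (ha : ∀ z, Commute a' z)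
    (hb : ∀ z, Commute b' z) : a * a' * (b * b') * (c * c') = a * b * c * (a' * b' * c') := by
  simp only [mul_assoc]
  rw [(hb c).left_comm, (ha b).left_comm, (ha c).left_comm]

theorem coboundary_mul {l m : Reg k H} (hl : l ∈ RegLazy1 k H) (hm : m ∈ RegLazy1 k H) :
    coboundary (l * m) = coboundary l * coboundary m := by
  have e : (l * m)⁻¹ = l⁻¹ * m⁻¹ := by rw [(central_of_lazy hl m).eq, mul_inv_rev]
  unfold coboundary
  rw [e, map_mul, map_mul, map_mul]
  exact mul_rearrange (central_of_lazy (pr₁_lazy hm)) (central_of_lazy (pr₂_lazy hm))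

variable (k H) in
/-- `B²_ℓ(H)`: the group of the `∂l` with `l ∈ Reg¹_ℓ(H)`. -/
noncomputable def LazyB2 : Subgroup (Reg k (H ⊗[k] H)) where
  carrier := {s | ∃ l ∈ RegLazy1 k H, coboundary l = s}
  one_mem' := ⟨1, one_mem _, by simp [coboundary]⟩
  mul_mem' := by
    rintro _ _ ⟨l, hl, rfl⟩ ⟨m, hm, rfl⟩
    exact ⟨l * m, mul_mem hl hm, coboundary_mul hl hm⟩
  inv_mem' := by
    rintro _ ⟨l, hl, rfl⟩
    refine ⟨l⁻¹, inv_mem hl, ?_⟩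
    apply eq_inv_of_mul_eq_one_left
    rw [← coboundary_mul (inv_mem hl) hl, inv_mul_cancel]
    simp [coboundary]

theorem coboundary_commute {l : Reg k H} (hl : l ∈ RegLazy1 k H) {s : Reg k (H ⊗[k] H)}
    (hs : s ∈ RegLazy2 k H) : Commute (coboundary l) s := by
  have a := central_of_lazy (pr₁_lazy hl) s
  have b := central_of_lazy (pr₂_lazy hl) s
  have c : Commute s (pull (mulC k H) l⁻¹) := commute_pull_of_lazyWith (g := mulC k H) hs l⁻¹
  exact (a.mul_left b).mul_left c.symm

theorem coboundary_mem_RegLazy2 {l : Reg k H} (hl : l ∈ RegLazy1 k H) :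
    coboundary l ∈ RegLazy2 k H := by
  refine mul_mem (mul_mem ?_ ?_) ?_
  · exact lazyWith_comp (pr₁_lazy hl) (LinearMap.mul' k H)
  · exact lazyWith_comp (pr₂_lazy hl) (LinearMap.mul' k H)
  · exact lazyWith_pull (inv_mem hl) (mulC k H)

theorem pull_congr {f g : (H ⊗[k] H) ⊗[k] H →ₗc[k] H}
    (h : ∀ x y z : H, f ((x ⊗ₜ y) ⊗ₜ z) = g ((x ⊗ₜ y) ⊗ₜ z)) (l : Reg k H) :
    pull f l = pull g l := by
  have e : (f : (H ⊗[k] H) ⊗[k] H →ₗ[k] H) = g := TensorProduct.ext_threefold h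
  apply Units.ext
  apply WithConv.ext
  exact congrArg ((l : WithConv (H →ₗ[k] k)).ofConv ∘ₗ ·) e

/-- `x ⊗ y ⊗ z ↦ ε(y) ε(z) x`. -/
noncomputable def q₁ : (H ⊗[k] H) ⊗[k] H →ₗc[k] H :=
  (pr₁ : H ⊗[k] H →ₗc[k] H).comp (pr₁ : (H ⊗[k] H) ⊗[k] H →ₗc[k] H ⊗[k] H)

/-- `x ⊗ y ⊗ z ↦ ε(x) ε(z) y`. -/
noncomputable def q₂ : (H ⊗[k] H) ⊗[k] H →ₗc[k] H :=
  (pr₂ : H ⊗[k] H →ₗc[k] H).comp (pr₁ : (H ⊗[k] H) ⊗[k] H →ₗc[k] H ⊗[k] H)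

/-- `x ⊗ y ⊗ z ↦ ε(x) ε(y) z`. -/
noncomputable def q₃ : (H ⊗[k] H) ⊗[k] H →ₗc[k] H := pr₂

/-- `x ⊗ y ⊗ z ↦ xyz`. -/
noncomputable def mul₃ : (H ⊗[k] H) ⊗[k] H →ₗc[k] H :=
  (mulC k H).comp (Coalgebra.TensorProduct.map (mulC k H) (CoalgHom.id k H))

theorem pull_congr' {f g : H ⊗[k] (H ⊗[k] H) →ₗc[k] H}
    (h : ∀ x y z : H, f (x ⊗ₜ (y ⊗ₜ z)) = g (x ⊗ₜ (y ⊗ₜ z))) (l : Reg k H) :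
    pull f l = pull g l := by
  have e : (f : H ⊗[k] (H ⊗[k] H) →ₗ[k] H) = g := by
    ext x y z
    exact h x y z
  apply Units.ext
  apply WithConv.ext
  exact congrArg ((l : WithConv (H →ₗ[k] k)).ofConv ∘ₗ ·) e

theorem mul_rearrange' {G : Type*} [Group G] {a b c m n : G} (ha : ∀ z, Commute a z) :
    b * c * m⁻¹ * (a * m * n⁻¹) = a * b * c * n⁻¹ := by
  rw [mul_assoc a m, ← mul_assoc _ a, ← (ha _).eq]
  simp only [mul_assoc, inv_mul_cancel_left]

theorem cocycleL_coboundary (l : Reg k H) :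
    cocycleL (coboundary l) = pull q₁ l * pull q₂ l * pull q₃ l * (pull mul₃ l)⁻¹ := by
  have h1 : pull (Coalgebra.TensorProduct.map (mulC k H) (CoalgHom.id k H))
      (pull (pr₁ : H ⊗[k] H →ₗc[k] H) l) =
      pull (pr₁ : (H ⊗[k] H) ⊗[k] H →ₗc[k] H ⊗[k] H) (pull (mulC k H) l) := by
    rw [pull_pull, pull_pull]
    exact pull_congr (fun x y z => by simp) l
  have h2 : pull (Coalgebra.TensorProduct.map (mulC k H) (CoalgHom.id k H))
      (pull (pr₂ : H ⊗[k] H →ₗc[k] H) l) = pull q₃ l := by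
    rw [pull_pull]
    exact pull_congr (fun x y z => by simp [q₃, mul_comm]) l
  unfold cocycleL coboundary
  simp only [map_mul, map_inv]
  rw [h1, h2, ← mul_assoc, ← mul_assoc, inv_mul_cancel_right]
  rfl

theorem cocycleR_coboundary {l : Reg k H} (hl : l ∈ RegLazy1 k H) :
    cocycleR (coboundary l) = pull q₁ l * pull q₂ l * pull q₃ l * (pull mul₃ l)⁻¹ := by
  have hc : ∀ z, Commute (pull (pr₁ : H ⊗[k] (H ⊗[k] H) →ₗc[k] H) l) z :=
    central_of_lazy (pr₁_lazy (A := H) (B := H ⊗[k] H) hl)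
  have h1 : pull (Coalgebra.TensorProduct.map (CoalgHom.id k H) (mulC k H))
      (pull (pr₁ : H ⊗[k] H →ₗc[k] H) l) = pull (pr₁ : H ⊗[k] (H ⊗[k] H) →ₗc[k] H) l := by
    rw [pull_pull]
    exact pull_congr' (fun x y z => by simp [mul_comm]) l
  have h2 : pull (Coalgebra.TensorProduct.map (CoalgHom.id k H) (mulC k H))
      (pull (pr₂ : H ⊗[k] H →ₗc[k] H) l) =
      pull (pr₂ : H ⊗[k] (H ⊗[k] H) →ₗc[k] H ⊗[k] H) (pull (mulC k H) l) := by
    rw [pull_pull, pull_pull]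
    exact pull_congr' (fun x y z => by simp) l
  have e1 : pull q₁ l = pull (Coalgebra.TensorProduct.assoc k k H H H).toCoalgHom
      (pull (pr₁ : H ⊗[k] (H ⊗[k] H) →ₗc[k] H) l) := by
    rw [pull_pull]
    exact pull_congr (fun x y z => by simp [q₁, mul_smul]) l
  have e2 : pull q₂ l = pull (Coalgebra.TensorProduct.assoc k k H H H).toCoalgHom
      (pull (pr₂ : H ⊗[k] (H ⊗[k] H) →ₗc[k] H ⊗[k] H) (pull (pr₁ : H ⊗[k] H →ₗc[k] H) l)) := by
    rw [pull_pull, pull_pull]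
    exact pull_congr (fun x y z => by simp [q₂, smul_smul, mul_comm]) l
  have e3 : pull q₃ l = pull (Coalgebra.TensorProduct.assoc k k H H H).toCoalgHom
      (pull (pr₂ : H ⊗[k] (H ⊗[k] H) →ₗc[k] H ⊗[k] H) (pull (pr₂ : H ⊗[k] H →ₗc[k] H) l)) := by
    rw [pull_pull, pull_pull]
    exact pull_congr (fun x y z => by simp [q₃, smul_smul, mul_comm]) l
  have e4 : pull mul₃ l = pull (Coalgebra.TensorProduct.assoc k k H H H).toCoalgHom
      (pull (Coalgebra.TensorProduct.map (CoalgHom.id k H) (mulC k H)) (pull (mulC k H) l)) := by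
    rw [pull_pull, pull_pull]
    exact pull_congr (fun x y z => by simp [mul₃, mul_assoc]) l
  rw [e1, e2, e3, e4]
  unfold cocycleR coboundary
  simp only [← map_mul, ← map_inv]
  congr 1
  simp only [map_mul, map_inv]
  rw [h1, h2]
  exact mul_rearrange' hc

theorem LazyB2_le_LazyZ2 : LazyB2 k H ≤ LazyZ2 k H := by
  rintro _ ⟨l, hl, rfl⟩
  exact ⟨coboundary_mem_RegLazy2 hl, by rw [cocycleL_coboundary, cocycleR_coboundary hl]⟩

instance : ((LazyB2 k H).subgroupOf (LazyZ2 k H)).Normal := by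
  constructor
  rintro ⟨s, hs⟩ ⟨l, hl, e⟩ ⟨t, ht⟩
  have h := coboundary_commute hl ht.1
  refine ⟨l, hl, ?_⟩
  rw [e] at h ⊢
  change s = t * s * t⁻¹
  rw [← (show Commute s t from h).eq, mul_inv_cancel_right]

variable (k H) in
/-- The second lazy cohomology group `H²_ℓ(H) = Z²_ℓ(H) / B²_ℓ(H)`. -/
abbrev LazyH2 : Type (max u v) := LazyZ2 k H ⧸ (LazyB2 k H).subgroupOf (LazyZ2 k H)

end Lazy

section Twist

variable (k : Type u) [Field k] (H : Type v) [Ring H] [HopfAlgebra k H]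

/-- `A¹(H)`: the central units of `H`. -/
def TwistA1 : Subgroup Hˣ where
  carrier := {a | ∀ x : H, (a : H) * x = x * a}
  one_mem' x := by simp
  mul_mem' {a b} ha hb x := by
    have h1 : Commute (a : H) x := ha x
    have h2 : Commute (b : H) x := hb x
    exact h1.mul_left h2
  inv_mem' {a} ha x := by
    have h1 : Commute (a : H) x := ha x
    exact h1.units_inv_left

/-- `A²(H)`: the invertible `F ∈ H ⊗ H` with `Δ(a) F = F Δ(a)` for all `a ∈ H`. -/
noncomputable def TwistA2 : Subgroup (H ⊗[k] H)ˣ where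
  carrier := {F | ∀ a : H, Coalgebra.comul (R := k) a * (F : H ⊗[k] H) =
    (F : H ⊗[k] H) * Coalgebra.comul (R := k) a}
  one_mem' a := by simp
  mul_mem' {F F'} h h' a := by
    have h1 : Commute (Coalgebra.comul (R := k) a) (F : H ⊗[k] H) := h a
    have h2 : Commute (Coalgebra.comul (R := k) a) (F' : H ⊗[k] H) := h' a
    exact h1.mul_right h2
  inv_mem' {F} h a := by
    have h1 : Commute (Coalgebra.comul (R := k) a) (F : H ⊗[k] H) := h a
    exact h1.units_inv_right

variable {k H}

/-- `(F ⊗ 1) (Δ ⊗ id)(F)`. -/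
noncomputable def deltaL (F : (H ⊗[k] H)ˣ) : (H ⊗[k] H) ⊗[k] H :=
  ((F : H ⊗[k] H) ⊗ₜ[k] (1 : H)) *
    Algebra.TensorProduct.map (Bialgebra.comulAlgHom k H) (AlgHom.id k H) (F : H ⊗[k] H)

/-- `(1 ⊗ F) (id ⊗ Δ)(F)`. -/
noncomputable def deltaR (F : (H ⊗[k] H)ˣ) : H ⊗[k] (H ⊗[k] H) :=
  ((1 : H) ⊗ₜ[k] (F : H ⊗[k] H)) *
    Algebra.TensorProduct.map (AlgHom.id k H) (Bialgebra.comulAlgHom k H) (F : H ⊗[k] H)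

theorem deltaL_mul {F F' : (H ⊗[k] H)ˣ} (hF' : F' ∈ TwistA2 k H) :
    deltaL (F * F') = deltaL F * deltaL F' := by
  have key : ∀ t : H ⊗[k] H, Commute ((F' : H ⊗[k] H) ⊗ₜ[k] (1 : H))
      (Algebra.TensorProduct.map (Bialgebra.comulAlgHom k H) (AlgHom.id k H) t) := by
    intro t
    induction t with
    | zero => simp
    | add a b ha hb => rw [map_add]; exact ha.add_right hb
    | tmul x y =>
      have := (hF' x).symm
      simp [Commute, SemiconjBy, this]
  have e : ((F : H ⊗[k] H) * (F' : H ⊗[k] H)) ⊗ₜ[k] (1 : H) =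
      ((F : H ⊗[k] H) ⊗ₜ[k] (1 : H)) * ((F' : H ⊗[k] H) ⊗ₜ[k] (1 : H)) := by simp
  unfold deltaL
  rw [Units.val_mul, map_mul, e]
  simp only [mul_assoc]
  rw [(key _).left_comm]

theorem deltaR_mul {F F' : (H ⊗[k] H)ˣ} (hF' : F' ∈ TwistA2 k H) :
    deltaR (F * F') = deltaR F * deltaR F' := by
  have key : ∀ t : H ⊗[k] H, Commute ((1 : H) ⊗ₜ[k] (F' : H ⊗[k] H))
      (Algebra.TensorProduct.map (AlgHom.id k H) (Bialgebra.comulAlgHom k H) t) := by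
    intro t
    induction t with
    | zero => simp
    | add a b ha hb => rw [map_add]; exact ha.add_right hb
    | tmul x y =>
      have := (hF' y).symm
      simp [Commute, SemiconjBy, this]
  have e : (1 : H) ⊗ₜ[k] ((F : H ⊗[k] H) * (F' : H ⊗[k] H)) =
      ((1 : H) ⊗ₜ[k] (F : H ⊗[k] H)) * ((1 : H) ⊗ₜ[k] (F' : H ⊗[k] H)) := by simp
  unfold deltaR
  rw [Units.val_mul, map_mul, e]
  simp only [mul_assoc]
  rw [(key _).left_comm]

theorem deltaL_one : deltaL (1 : (H ⊗[k] H)ˣ) = 1 := by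
  simp [deltaL, ← Algebra.TensorProduct.one_def]

theorem deltaR_one : deltaR (1 : (H ⊗[k] H)ˣ) = 1 := by
  simp [deltaR, ← Algebra.TensorProduct.one_def]

variable (k H) in
/-- `Z²(H)`: the group of invariant twists, that is of all `F ∈ A²(H)` with
`(F ⊗ 1) (Δ ⊗ id)(F) = (1 ⊗ F) (id ⊗ Δ)(F)`. -/
noncomputable def TwistZ2 : Subgroup (H ⊗[k] H)ˣ where
  carrier := {F | F ∈ TwistA2 k H ∧
    Algebra.TensorProduct.assoc k k k H H H (deltaL F) = deltaR F}
  one_mem' := ⟨one_mem _, by rw [deltaL_one, deltaR_one, map_one]⟩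
  mul_mem' {F F'} h h' := ⟨mul_mem h.1 h'.1, by
    rw [deltaL_mul h'.1, deltaR_mul h'.1, map_mul, h.2, h'.2]⟩
  inv_mem' {F} h := ⟨inv_mem h.1, by
    have h1 := deltaL_mul (F := F) (inv_mem h.1)
    have h2 := deltaR_mul (F := F⁻¹) h.1
    rw [mul_inv_cancel, deltaL_one] at h1
    rw [inv_mul_cancel, deltaR_one] at h2
    have h3 := congrArg (Algebra.TensorProduct.assoc k k k H H H) h1
    rw [map_one, map_mul, h.2] at h3
    exact (left_inv_eq_right_inv h2.symm h3.symm).symm⟩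

/-- `δ¹(a) = (a ⊗ a) Δ(a⁻¹)`. -/
noncomputable def delta1 (a : Hˣ) : (H ⊗[k] H)ˣ :=
  Units.map (Algebra.TensorProduct.includeLeft : H →ₐ[k] H ⊗[k] H).toMonoidHom a *
    Units.map (Algebra.TensorProduct.includeRight : H →ₐ[k] H ⊗[k] H).toMonoidHom a *
    Units.map (Bialgebra.comulAlgHom k H).toMonoidHom a⁻¹

theorem delta1_val (a : Hˣ) : ((delta1 a : (H ⊗[k] H)ˣ) : H ⊗[k] H) =
    ((a : H) ⊗ₜ[k] (a : H)) * Coalgebra.comul (R := k) ((a⁻¹ : Hˣ) : H) := by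
  simp [delta1]

theorem tmul_commute {a b : Hˣ} (ha : a ∈ TwistA1 H) (hb : b ∈ TwistA1 H) (t : H ⊗[k] H) :
    Commute ((a : H) ⊗ₜ[k] (b : H)) t := by
  induction t with
  | zero => simp
  | add a b ha hb => exact ha.add_right hb
  | tmul x y => simp [Commute, SemiconjBy, ha x, hb y]

theorem delta1_mul {a b : Hˣ} (ha : a ∈ TwistA1 H) (hb : b ∈ TwistA1 H) :
    (delta1 (a * b) : (H ⊗[k] H)ˣ) = delta1 a * delta1 b := by
  apply Units.ext
  have e : (a * b)⁻¹ = a⁻¹ * b⁻¹ := by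
    rw [show a * b = b * a from Units.ext (ha b), mul_inv_rev]
  have e2 : ((a : H) * b) ⊗ₜ[k] ((a : H) * b) = ((a : H) ⊗ₜ[k] (a : H)) * ((b : H) ⊗ₜ[k] (b : H)) := by
    simp
  rw [Units.val_mul]
  simp only [delta1_val]
  rw [e, Units.val_mul, Units.val_mul, e2, Bialgebra.comul_mul]
  simp only [mul_assoc]
  rw [(tmul_commute hb hb _).left_comm]

theorem delta1_one : (delta1 1 : (H ⊗[k] H)ˣ) = 1 := by simp [delta1]

variable (k H) in
/-- `Im(δ¹)`: the group of the `δ¹(a)` with `a ∈ A¹(H)`. -/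
noncomputable def TwistB2 : Subgroup (H ⊗[k] H)ˣ where
  carrier := {F | ∃ a ∈ TwistA1 H, delta1 a = F}
  one_mem' := ⟨1, one_mem _, delta1_one⟩
  mul_mem' := by
    rintro _ _ ⟨a, ha, rfl⟩ ⟨b, hb, rfl⟩
    exact ⟨a * b, mul_mem ha hb, delta1_mul ha hb⟩
  inv_mem' := by
    rintro _ ⟨a, ha, rfl⟩
    refine ⟨a⁻¹, inv_mem ha, ?_⟩
    apply eq_inv_of_mul_eq_one_left
    rw [← delta1_mul (inv_mem ha) ha, inv_mul_cancel, delta1_one]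

theorem delta1_commute {a : Hˣ} (ha : a ∈ TwistA1 H) {F : (H ⊗[k] H)ˣ} (hF : F ∈ TwistA2 k H) :
    Commute (delta1 a) F := by
  apply Units.ext
  have h : Commute (Coalgebra.comul (R := k) ((a⁻¹ : Hˣ) : H)) (F : H ⊗[k] H) := hF _
  rw [Units.val_mul, Units.val_mul, delta1_val]
  exact (tmul_commute ha ha _).mul_left h

theorem delta1_mem_TwistA2 {a : Hˣ} (ha : a ∈ TwistA1 H) : delta1 a ∈ TwistA2 k H := by
  intro x
  rw [delta1_val]
  have h : Commute (Coalgebra.comul (R := k) x) (Coalgebra.comul (R := k) ((a⁻¹ : Hˣ) : H)) := by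
    have e : Commute x ((a⁻¹ : Hˣ) : H) := ((inv_mem ha : a⁻¹ ∈ TwistA1 H) x).symm
    have := e.map (Bialgebra.comulAlgHom k H)
    exact this
  exact (tmul_commute ha ha _).symm.mul_right h

theorem comul_inv_mul_comul (a : Hˣ) :
    Coalgebra.comul (R := k) ((a⁻¹ : Hˣ) : H) * Coalgebra.comul (R := k) (a : H) = 1 := by
  rw [← Bialgebra.comul_mul, Units.inv_mul, Bialgebra.comul_one]

theorem deltaL_delta1 (a : Hˣ) : deltaL (delta1 a : (H ⊗[k] H)ˣ) =
    (((a : H) ⊗ₜ[k] (a : H)) ⊗ₜ[k] (a : H)) *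
      Algebra.TensorProduct.map (Bialgebra.comulAlgHom k H) (AlgHom.id k H)
        (Coalgebra.comul (R := k) ((a⁻¹ : Hˣ) : H)) := by
  unfold deltaL
  rw [delta1_val, map_mul, ← mul_assoc, Algebra.TensorProduct.map_tmul,
    Algebra.TensorProduct.tmul_mul_tmul, Bialgebra.comulAlgHom_apply, mul_assoc,
    comul_inv_mul_comul, mul_one, one_mul, AlgHom.id_apply]

theorem deltaR_delta1 (a : Hˣ) : deltaR (delta1 a : (H ⊗[k] H)ˣ) =
    ((a : H) ⊗ₜ[k] ((a : H) ⊗ₜ[k] (a : H))) *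
      Algebra.TensorProduct.map (AlgHom.id k H) (Bialgebra.comulAlgHom k H)
        (Coalgebra.comul (R := k) ((a⁻¹ : Hˣ) : H)) := by
  unfold deltaR
  rw [delta1_val, map_mul, ← mul_assoc, Algebra.TensorProduct.map_tmul,
    Algebra.TensorProduct.tmul_mul_tmul, Bialgebra.comulAlgHom_apply, mul_assoc,
    comul_inv_mul_comul, mul_one, one_mul, AlgHom.id_apply]

theorem TwistB2_le_TwistZ2 : TwistB2 k H ≤ TwistZ2 k H := by
  rintro _ ⟨a, ha, rfl⟩
  refine ⟨delta1_mem_TwistA2 ha, ?_⟩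
  rw [deltaL_delta1, deltaR_delta1, map_mul, Algebra.TensorProduct.assoc_tmul]
  congr 1
  exact Coalgebra.coassoc_apply ((a⁻¹ : Hˣ) : H)

instance : ((TwistB2 k H).subgroupOf (TwistZ2 k H)).Normal := by
  constructor
  rintro ⟨F, hF⟩ ⟨a, ha, e⟩ ⟨F', hF'⟩
  have h := delta1_commute ha hF'.1
  refine ⟨a, ha, ?_⟩
  rw [e] at h ⊢
  change F = F' * F * F'⁻¹
  rw [← (show Commute F F' from h).eq, mul_inv_cancel_right]

variable (k H) in
/-- The second twist cohomology group `H²_tw(H) = Z²(H) / Im(δ¹)`. -/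
abbrev TwistH2 : Type v := TwistZ2 k H ⧸ (TwistB2 k H).subgroupOf (TwistZ2 k H)

end Twist

section FunctionAlgebra

/-- The algebra `O_k(G)` of `k`-valued functions on `G`, with pointwise operations. -/
def FunctionAlgebra (k : Type u) (G : Type w) : Type (max u w) := G → k

variable (k : Type u) [Field k] (G : Type w)

noncomputable instance : CommRing (FunctionAlgebra k G) := inferInstanceAs (CommRing (G → k))

noncomputable instance : Algebra k (FunctionAlgebra k G) := inferInstanceAs (Algebra k (G → k))

instance [Finite G] : Module.Finite k (FunctionAlgebra k G) :=
  inferInstanceAs (Module.Finite k (G → k))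

/-- The identification of `O_k(G)` with the product algebra `G → k`. -/
noncomputable def toPi : FunctionAlgebra k G ≃ₐ[k] (G → k) := AlgEquiv.refl

variable {G}

/-- Evaluation at `g`. -/
noncomputable def ev (g : G) : FunctionAlgebra k G →ₐ[k] k :=
  (Pi.evalAlgHom k (fun _ : G => k) g).comp (toPi k G).toAlgHom

open Classical in
/-- `e_g`: the characteristic function of `{g}`. -/
noncomputable def charFun (g : G) : FunctionAlgebra k G := (toPi k G).symm (Pi.single g 1)

variable {k} in
theorem ev_ext {f f' : FunctionAlgebra k G} (h : ∀ g, ev k g f = ev k g f') : f = f' :=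
  (toPi k G).injective (funext h)

open Classical in
theorem ev_charFun (g x : G) : ev k x (charFun k g) = if x = g then 1 else 0 := by
  simp [ev, charFun, Pi.single_apply]

open Classical in
theorem charFun_mul_charFun (g h : G) :
    charFun k g * charFun k h = if g = h then charFun k g else 0 := by
  apply ev_ext
  intro x
  rw [map_mul, ev_charFun, ev_charFun]
  split_ifs <;> simp_all [ev_charFun]

variable [Fintype G]

theorem sum_charFun (f : FunctionAlgebra k G) : ∑ g, ev k g f • charFun k g = f := by
  classical
  apply ev_ext
  intro x
  simp [map_sum, ev_charFun]

theorem sum_charFun_eq_one : ∑ g : G, charFun k g = 1 := by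
  have h := sum_charFun k (1 : FunctionAlgebra k G)
  simpa using h

variable {k} in
theorem hom_ext {M : Type*} [AddCommMonoid M] [Module k M] {φ ψ : FunctionAlgebra k G →ₗ[k] M}
    (h : ∀ g, φ (charFun k g) = ψ (charFun k g)) : φ = ψ := by
  ext f
  rw [← sum_charFun k f, map_sum, map_sum]
  exact Finset.sum_congr rfl fun g _ => by rw [map_smul, map_smul, h]

variable [Group G]

/-- `Δ(e_g) = ∑_h e_h ⊗ e_{h⁻¹g}`, `ε(e_g) = δ_{g,1}`. -/
noncomputable instance : CoalgebraStruct k (FunctionAlgebra k G) where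
  comul := ∑ g : G, (ev k g).toLinearMap.smulRight
    (∑ h : G, charFun k h ⊗ₜ[k] charFun k (h⁻¹ * g))
  counit := (ev k 1).toLinearMap

theorem comul_charFun (g : G) : Coalgebra.comul (R := k) (charFun k g) =
    ∑ h : G, charFun k h ⊗ₜ[k] charFun k (h⁻¹ * g) := by
  classical
  change (∑ g' : G, (ev k g').toLinearMap.smulRight
    (∑ h : G, charFun k h ⊗ₜ[k] charFun k (h⁻¹ * g'))) (charFun k g) = _
  simp [LinearMap.sum_apply, ev_charFun]

theorem counit_apply (f : FunctionAlgebra k G) : Coalgebra.counit (R := k) f = ev k 1 f := rfl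

noncomputable instance : Coalgebra k (FunctionAlgebra k G) where
  coassoc := by
    apply hom_ext
    intro g
    simp only [LinearMap.comp_apply, comul_charFun, map_sum, LinearMap.rTensor_tmul,
      LinearMap.lTensor_tmul, TensorProduct.sum_tmul, TensorProduct.tmul_sum,
      LinearEquiv.coe_coe, TensorProduct.assoc_tmul]
    rw [Finset.sum_comm]
    refine Finset.sum_congr rfl fun a _ => ?_
    refine Fintype.sum_equiv (Equiv.mulLeft a⁻¹) _ _ fun h => ?_
    simp [mul_assoc]
  rTensor_counit_comp_comul := by
    classical
    apply hom_ext
    intro g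
    simp [comul_charFun, counit_apply, ev_charFun, TensorProduct.ite_tmul]
  lTensor_counit_comp_comul := by
    classical
    apply hom_ext
    intro g
    have h : ∀ x : G, 1 = x⁻¹ * g ↔ x = g := fun x => by rw [eq_comm, inv_mul_eq_one]
    simp [comul_charFun, counit_apply, ev_charFun, TensorProduct.tmul_ite, h]

theorem comul_mul_aux (f f' : FunctionAlgebra k G) : Coalgebra.comul (R := k) (f * f') =
    Coalgebra.comul (R := k) f * Coalgebra.comul (R := k) f' := by
  classical
  have key : ∀ g g' : G, Coalgebra.comul (R := k) (charFun k g * charFun k g') =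
      Coalgebra.comul (R := k) (charFun k g) * Coalgebra.comul (R := k) (charFun k g') := by
    intro g g'
    simp only [comul_charFun, Finset.sum_mul_sum, Algebra.TensorProduct.tmul_mul_tmul,
      charFun_mul_charFun]
    by_cases h : g = g'
    · simp [h, TensorProduct.ite_tmul, comul_charFun]
    · simp [h, TensorProduct.ite_tmul]
  rw [← sum_charFun k f, ← sum_charFun k f']
  simp only [Finset.sum_mul_sum, map_sum, smul_mul_smul_comm, map_smul, key]

theorem comul_one_aux : Coalgebra.comul (R := k) (1 : FunctionAlgebra k G) = 1 := by
  rw [← sum_charFun_eq_one k, map_sum]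
  simp only [comul_charFun]
  rw [Finset.sum_comm, Algebra.TensorProduct.one_def]
  conv_rhs => rw [← sum_charFun_eq_one k (G := G), TensorProduct.sum_tmul]
  refine Finset.sum_congr rfl fun h _ => ?_
  rw [TensorProduct.tmul_sum]
  exact Fintype.sum_equiv (Equiv.mulLeft h⁻¹) _ _ fun _ => rfl

noncomputable instance : Bialgebra k (FunctionAlgebra k G) :=
  Bialgebra.mk' k (FunctionAlgebra k G) (map_one (ev k 1)) (map_mul (ev k 1) _ _)
    (comul_one_aux k) (comul_mul_aux k _ _)

/-- `S(e_g) = e_{g⁻¹}`. -/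
noncomputable instance : HopfAlgebraStruct k (FunctionAlgebra k G) where
  antipode := ∑ g : G, (ev k g).toLinearMap.smulRight (charFun k g⁻¹)

theorem antipode_charFun (g : G) :
    HopfAlgebra.antipode k (charFun k g) = charFun k g⁻¹ := by
  classical
  change (∑ g' : G, (ev k g').toLinearMap.smulRight (charFun k g'⁻¹)) (charFun k g) = _
  simp [LinearMap.sum_apply, ev_charFun]

/-- The Hopf algebra `O_k(G)` of functions on a finite group `G`. -/
noncomputable instance : HopfAlgebra k (FunctionAlgebra k G) where
  mul_antipode_rTensor_comul := by
    classical
    apply hom_ext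
    intro g
    simp [comul_charFun, antipode_charFun, counit_apply, ev_charFun, charFun_mul_charFun]
    by_cases h : g = 1
    · subst h; simpa using (Equiv.sum_comp (Equiv.inv G) (charFun k)).trans (sum_charFun_eq_one k)
    · simp [h, Ne.symm h]
  mul_antipode_lTensor_comul := by
    classical
    apply hom_ext
    intro g
    simp [comul_charFun, antipode_charFun, counit_apply, ev_charFun, charFun_mul_charFun]
    by_cases h : g = 1
    · subst h; simpa using sum_charFun_eq_one k (G := G)
    · simp [h, Ne.symm h]

end FunctionAlgebra

section Automorphisms

variable (G : Type w) [Group G]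

/-- The group of class-preserving automorphisms of `G`. -/
def AutC : Subgroup (MulAut G) where
  carrier := {φ | ∀ g, IsConj g (φ g)}
  one_mem' g := IsConj.refl g
  mul_mem' {φ ψ} h h' g := (h' g).trans (h (ψ g))
  inv_mem' {φ} h g := by
    have := h (φ⁻¹ g)
    rw [MulAut.apply_inv_self] at this
    exact this.symm

/-- The group of inner automorphisms of `G`. -/
def InnerAut : Subgroup (MulAut G) := (MulAut.conj (G := G)).range

theorem InnerAut_le_AutC : InnerAut G ≤ AutC G := by
  rintro _ ⟨a, rfl⟩ g
  exact isConj_iff.mpr ⟨a, rfl⟩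

instance : (InnerAut G).Normal := by
  constructor
  rintro _ ⟨a, rfl⟩ φ
  refine ⟨φ a, ?_⟩
  ext x
  simp [MulAut.conj_apply]

/-- The quotient `Aut_c(G) / Inn(G)`. -/
abbrev OutC : Type w := AutC G ⧸ (InnerAut G).subgroupOf (AutC G)

end Automorphisms
end LazyCoh

/-!
For `k` algebraically closed of characteristic not dividing `|G|`, the non-commutativity of
`OutC G = Aut_c(G) / Inn(G)` passes to `TwistH2 k (MonoidAlgebra k G)` and to
`LazyH2 k (FunctionAlgebra k G)`. It then suffices to find one group with `OutC G` non-abelian.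

*Transfer.* A class-preserving automorphism `φ` of `G` fixes the centre of `k[G]`, so it preserves
each matrix block of `k[G]` and is conjugation by a unit `a` of `k[G]` by Skolem–Noether
(`exists_unit_of_mem_AutC`). The element `δ¹(a) = (a ⊗ a) Δ(a⁻¹)` satisfies the twist equation for
every unit `a`, and here it is invariant because `a` normalizes `G` (`delta1_mem_TwistZ2`). On such
units `δ¹` is multiplicative. If `δ¹(a) = δ¹(c)` with `c` central, then `c⁻¹ a` is group-like, hence
in `G`, and `φ` is inner. So commutators that are not inner give commutators of twists that are
not coboundaries (`exists_noncomm_of_outC`). The argument for `O_k(G)` is the same with the dual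
algebra of `O_k(G)`, which receives `k[G]`, and with the coboundaries `∂a` of forms `a` that are not
lazy but normalize the set of points of `G` (`coboundary_mem_LazyZ2`); group-like elements of the dual
are the multiplicative forms, that is the points of `G`.

*The group.* Let `F` be the field with `q = p ^ m` elements and `σ` its Frobenius automorphism. The
matrices `[[1, x, z], [0, 1, σ x], [0, 0, 1]]` form a group `Q`, and `SahGroup σ = F³ ⋊ Q` has order
`q ^ 5`. The semilinear map `σ⁻¹` provides an automorphism `vecAut σ` coming from an endomorphism of
the `Q`-module `F³` and an automorphism `derAut σ` coming from a cocycle `Q → F³`. Each agrees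
elementwise with a conjugation, since multiplication by a non-zero element of `F` is
surjective. Their commutator is given by `x ↦ σ⁻² x`, which for `m ≥ 3` is not a multiple of
`x ↦ x`, so that it is not inner (`SahGroup.outC_noncomm`).
-/

namespace LazyCoh

/-! ### Class-preserving automorphisms in the group algebra -/

/-- Skolem–Noether for a matrix algebra. -/
theorem exists_unit_matrix_algEquiv {k : Type u} [Field k] {d : ℕ}
    (f : Matrix (Fin d) (Fin d) k ≃ₐ[k] Matrix (Fin d) (Fin d) k) :
    ∃ a : (Matrix (Fin d) (Fin d) k)ˣ, ∀ x, (a : Matrix (Fin d) (Fin d) k) * x = f x * a := by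
  let e := Matrix.toLinAlgEquiv' (R := k) (n := Fin d)
  obtain ⟨T, hT⟩ := ((e.symm.trans f).trans e).eq_linearEquivConjAlgEquiv
  let t : (Module.End k (Fin d → k))ˣ := LinearMap.GeneralLinearGroup.ofLinearEquiv T
  refine ⟨Units.map e.symm.toMonoidHom t, fun x => e.injective ?_⟩
  have h := DFunLike.congr_fun hT (e x)
  simp only [AlgEquiv.trans_apply, AlgEquiv.symm_apply_apply] at h
  rw [map_mul, map_mul, h]
  change e (e.symm _) * _ = _ * e (e.symm _)
  rw [AlgEquiv.apply_symm_apply]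
  refine LinearMap.ext fun v => ?_
  change T (e x v) = T (e x (T.symm (T v)))
  rw [T.symm_apply_apply]

/-- Skolem–Noether for a finite product of matrix algebras: the automorphism `f` preserves each
factor because it fixes the central idempotents. -/
theorem exists_unit_pi_matrix_algEquiv {k : Type u} [Field k] {n : ℕ} {d : Fin n → ℕ}
    (f : (Π i, Matrix (Fin (d i)) (Fin (d i)) k) ≃ₐ[k] Π i, Matrix (Fin (d i)) (Fin (d i)) k)
    (hf : ∀ z, (∀ x, z * x = x * z) → f z = z) :
    ∃ a : (Π i, Matrix (Fin (d i)) (Fin (d i)) k)ˣ,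
      ∀ x, (a : Π i, Matrix (Fin (d i)) (Fin (d i)) k) * x = f x * a := by
  have hc (i) : f (Pi.single i 1) = Pi.single i 1 := by
    refine hf _ fun x => ?_
    rw [← Pi.single_mul_left, ← Pi.single_mul_right, one_mul, mul_one]
  have hc' (i) : f.symm (Pi.single i 1) = Pi.single i 1 := by rw [AlgEquiv.symm_apply_eq, hc]
  have hloc (g : (Π i, Matrix (Fin (d i)) (Fin (d i)) k) ≃ₐ[k]
      Π i, Matrix (Fin (d i)) (Fin (d i)) k) (i)
      (hg : g (Pi.single i 1) = Pi.single i 1) (x) : g (Pi.single i (x i)) i = g x i := by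
    have : (Pi.single i (x i) : Π i, Matrix (Fin (d i)) (Fin (d i)) k) = x * Pi.single i 1 := by
      rw [← Pi.single_mul_right, mul_one]
    rw [this, map_mul, hg, Pi.mul_apply, Pi.single_eq_same, mul_one]
  have hmul (i) (x y : Matrix (Fin (d i)) (Fin (d i)) k) :
      f (Pi.single i (x * y)) i = f (Pi.single i x) i * f (Pi.single i y) i := by
    rw [Pi.single_mul, map_mul, Pi.mul_apply]
  -- The automorphism that `f` induces on the `i`-th factor.
  let F (i) : Matrix (Fin (d i)) (Fin (d i)) k ≃ₐ[k] Matrix (Fin (d i)) (Fin (d i)) k :=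
    AlgEquiv.ofLinearEquiv
      { toFun := fun x => f (Pi.single i x) i
        invFun := fun x => f.symm (Pi.single i x) i
        map_add' := fun x y => by rw [Pi.single_add, map_add, Pi.add_apply]
        map_smul' := fun c x => by rw [Pi.single_smul, map_smul, Pi.smul_apply, RingHom.id_apply]
        left_inv := fun x => by
          refine (hloc f.symm i (hc' i) _).trans ?_
          rw [AlgEquiv.symm_apply_apply, Pi.single_eq_same]
        right_inv := fun x => by
          refine (hloc f i (hc i) _).trans ?_
          rw [AlgEquiv.apply_symm_apply, Pi.single_eq_same] }
      (by
        change f (Pi.single i 1) i = 1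
        rw [hc, Pi.single_eq_same])
      (hmul i)
  choose a ha using fun i => exists_unit_matrix_algEquiv (F i)
  refine ⟨MulEquiv.piUnits.symm a, fun x => funext fun i => ?_⟩
  refine (ha i (x i)).trans ?_
  exact congrArg (· * (a i : Matrix (Fin (d i)) (Fin (d i)) k)) (hloc f i (hc i) x)

open MonoidAlgebra in
/-- A class-preserving automorphism fixes the class functions, that is the centre of `k[G]`, and so
becomes inner in `k[G]`. -/
theorem exists_unit_of_mem_AutC {k : Type u} [Field k] [IsAlgClosed k] {G : Type w} [Group G]
    [Finite G] (hG : (Nat.card G : k) ≠ 0) {φ : MulAut G} (hφ : φ ∈ AutC G) :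
    ∃ a : (MonoidAlgebra k G)ˣ, ∀ g, (a : MonoidAlgebra k G) * of k G g = of k G (φ g) * a := by
  have : NeZero (Nat.card G : k) := ⟨hG⟩
  obtain ⟨n, d, -, ⟨e⟩⟩ :=
    IsSemisimpleRing.exists_algEquiv_pi_matrix_of_isAlgClosed k (MonoidAlgebra k G)
  let Φ : MonoidAlgebra k G ≃ₐ[k] MonoidAlgebra k G := domCongr k k φ
  have hΦ (z : MonoidAlgebra k G) (hz : ∀ x, z * x = x * z) : Φ z = z := by
    ext g
    obtain ⟨c, hc⟩ := isConj_iff.mp ((inv_mem hφ : φ⁻¹ ∈ AutC G) g)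
    rw [coeff_domCongr]
    change z.coeff (φ⁻¹ g) = _
    have h := congrArg (fun y => y.coeff (c * g)) (hz (of k G c))
    simpa [of_apply, hc] using h
  obtain ⟨a, ha⟩ := exists_unit_pi_matrix_algEquiv ((e.symm.trans Φ).trans e) fun z hz => by
    have : Φ (e.symm z) = e.symm z := hΦ _ fun x => e.injective (by simp [hz])
    simp [this]
  refine ⟨Units.map e.symm.toMonoidHom a, fun g => e.injective ?_⟩
  rw [map_mul, map_mul]
  change e (e.symm _) * _ = _ * e (e.symm _)
  rw [AlgEquiv.apply_symm_apply, ha]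
  simp [Φ]

/-! ### From outer class-preserving automorphisms to cohomology -/

/-- Transfer of non-commutativity from `OutC G` to a quotient `Z ⧸ B`. The group `G` sits in a group
`U` by `ι`, every class-preserving automorphism of `G` is induced by conjugation with an element
of `U`, and `D` is multiplicative on the elements of `U` that induce automorphisms of `G` and maps
them to `Z`; and `D` sends only products of an element centralizing `G` and an element of `G` to `B`. -/
theorem exists_noncomm_of_outC {G U X : Type*} [Group G] [Group U] [Group X] {ι : G →* U}
    (hι : Function.Injective ι)
    (hφ : ∀ φ ∈ AutC G, ∃ a : U, ∀ g, a * ι g = ι (φ g) * a)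
    (D : U → X) (Z B : Subgroup X) [(B.subgroupOf Z).Normal]
    (hZ : ∀ (φ : MulAut G) (a : U), (∀ g, a * ι g = ι (φ g) * a) → D a ∈ Z)
    (hmul : ∀ (a b : U) (φ : MulAut G), (∀ g, b * ι g = ι (φ g) * b) → D (a * b) = D a * D b)
    (hker : ∀ (a : U), D a ∈ B → ∃ g c, a = c * ι g ∧ ∀ h, Commute c (ι h))
    (h : ∃ a b : OutC G, a * b ≠ b * a) :
    ∃ a b : Z ⧸ B.subgroupOf Z, a * b ≠ b * a := by
  obtain ⟨φ', ψ', h⟩ := h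
  obtain ⟨⟨φ, hφ'⟩, rfl⟩ := QuotientGroup.mk_surjective φ'
  obtain ⟨⟨ψ, hψ'⟩, rfl⟩ := QuotientGroup.mk_surjective ψ'
  obtain ⟨a, ha⟩ := hφ φ hφ'
  obtain ⟨b, hb⟩ := hφ ψ hψ'
  refine ⟨QuotientGroup.mk ⟨D a, hZ φ a ha⟩, QuotientGroup.mk ⟨D b, hZ ψ b hb⟩, fun e => h ?_⟩
  rw [← QuotientGroup.mk_mul, ← QuotientGroup.mk_mul, QuotientGroup.eq] at e ⊢
  have comp {a b : U} {φ ψ : MulAut G} (ha : ∀ g, a * ι g = ι (φ g) * a)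
      (hb : ∀ g, b * ι g = ι (ψ g) * b) (g : G) : a * b * ι g = ι ((φ * ψ) g) * (a * b) := by
    rw [mul_assoc, hb, ← mul_assoc, ha, mul_assoc, MulAut.mul_apply]
  have inv {a : U} {φ : MulAut G} (ha : ∀ g, a * ι g = ι (φ g) * a) (g : G) :
      a⁻¹ * ι g = ι (φ⁻¹ g) * a⁻¹ := by
    rw [inv_mul_eq_iff_eq_mul, ← mul_assoc, ha, MulAut.apply_inv_self, mul_inv_cancel_right]
  have hc := comp (inv (comp ha hb)) (comp hb ha)
  have hD : D ((a * b)⁻¹ * (b * a)) = (D a * D b)⁻¹ * (D b * D a) := by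
    rw [eq_inv_mul_iff_mul_eq, ← hmul a b ψ hb, ← hmul b a φ ha, ← hmul _ _ _ hc,
      mul_inv_cancel_left]
  -- This element induces the commutator of the two automorphisms, which is thus inner.
  obtain ⟨g, c, e1, e2⟩ := hker _ (by rw [hD]; exact e)
  refine ⟨g, MulEquiv.ext fun x => hι ?_⟩
  have h1 := hc x
  rw [e1, mul_assoc, ← map_mul, (e2 _).eq, (e2 g).eq, ← mul_assoc, mul_left_inj, ← map_mul] at h1
  rw [MulAut.conj_apply, map_mul, ← map_mul, hι h1, mul_inv_cancel_right]
  rfl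

/-! ### Twist cohomology of the group algebra -/

section Twist

variable {k : Type u} [Field k] {G : Type w} [Group G]

/-- The embedding of `G` into the units of `k[G]`. -/
noncomputable def unitOf : G →* (MonoidAlgebra k G)ˣ := (MonoidAlgebra.of k G).toHomUnits

theorem unitOf_injective : Function.Injective (unitOf : G →* (MonoidAlgebra k G)ˣ) := fun _ _ e =>
  MonoidAlgebra.of_injective (congrArg Units.val e)

/-- `δ¹` is multiplicative as soon as `δ¹(b)` is invariant; neither `a` nor `b` needs to be central. -/
theorem delta1_mul_of_mem {H : Type*} [Ring H] [HopfAlgebra k H] (a : Hˣ) {b : Hˣ}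
    (hb : delta1 b ∈ TwistA2 k H) : (delta1 (a * b) : (H ⊗[k] H)ˣ) = delta1 a * delta1 b := by
  apply Units.ext
  have e2 : ((a : H) * b) ⊗ₜ[k] ((a : H) * b) =
      ((a : H) ⊗ₜ[k] (a : H)) * ((b : H) ⊗ₜ[k] (b : H)) := by simp
  rw [Units.val_mul, delta1_val a, mul_assoc, hb, delta1_val, delta1_val, mul_inv_rev,
    Units.val_mul, Units.val_mul, e2, Bialgebra.comul_mul]
  simp only [mul_assoc]

theorem comul_of (g : G) : Coalgebra.comul (R := k) (MonoidAlgebra.of k G g) =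
    MonoidAlgebra.of k G g ⊗ₜ[k] MonoidAlgebra.of k G g := by
  simp [MonoidAlgebra.of_apply]

/-- If conjugation with `a` induces an automorphism of `G`, then `δ¹(a)` is an invariant twist,
although `a` need not be central. -/
theorem delta1_mem_TwistZ2 {a : (MonoidAlgebra k G)ˣ} {φ : MulAut G}
    (ha : ∀ g, a * unitOf g = unitOf (φ g) * a) : delta1 a ∈ TwistZ2 k (MonoidAlgebra k G) := by
  have ha' (g : G) : (a : MonoidAlgebra k G) * MonoidAlgebra.of k G g =
      MonoidAlgebra.of k G (φ g) * a := congrArg Units.val (ha g)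
  have hinv (g : G) : ((a⁻¹ : (MonoidAlgebra k G)ˣ) : MonoidAlgebra k G) *
      MonoidAlgebra.of k G (φ g) = MonoidAlgebra.of k G g * (a⁻¹ : (MonoidAlgebra k G)ˣ) := by
    rw [Units.inv_mul_eq_iff_eq_mul, ← mul_assoc, ha', Units.mul_inv_cancel_right]
  refine ⟨fun x => ?_, ?_⟩
  · induction x using MonoidAlgebra.induction_on with
    | of g =>
      obtain ⟨g, rfl⟩ := φ.surjective g
      rw [delta1_val, mul_assoc, ← Bialgebra.comul_mul, hinv, Bialgebra.comul_mul, comul_of,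
        comul_of, ← mul_assoc, ← mul_assoc, Algebra.TensorProduct.tmul_mul_tmul,
        Algebra.TensorProduct.tmul_mul_tmul, ha']
    | add x y hx hy => rw [map_add, add_mul, mul_add, hx, hy]
    | smul r x hx => rw [map_smul, smul_mul_assoc, mul_smul_comm, hx]
  · rw [deltaL_delta1, deltaR_delta1, map_mul, Algebra.TensorProduct.assoc_tmul]
    congr 1
    exact Coalgebra.coassoc_apply ((a⁻¹ : (MonoidAlgebra k G)ˣ) : MonoidAlgebra k G)

/-- If `δ¹(a) = 1`, then `a` is group-like, hence an element of `G`. -/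
theorem exists_eq_of_delta1_eq_one {a : (MonoidAlgebra k G)ˣ}
    (ha : (delta1 a : (MonoidAlgebra k G ⊗[k] MonoidAlgebra k G)ˣ) = 1) : ∃ g, a = unitOf g := by
  have h := congrArg Units.val ha
  rw [delta1_val] at h
  have h1 : ((a : MonoidAlgebra k G) ⊗ₜ[k] (a : MonoidAlgebra k G)) =
      Coalgebra.comul (R := k) (a : MonoidAlgebra k G) := by
    have := congrArg (· * Coalgebra.comul (R := k) (a : MonoidAlgebra k G)) h
    simpa only [mul_assoc, comul_inv_mul_comul, mul_one, one_mul, Units.val_one] using this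
  have h2 : IsGroupLikeElem k (a : MonoidAlgebra k G) := by
    refine ⟨?_, h1.symm⟩
    have h3 := Coalgebra.rTensor_counit_comul (R := k) (a : MonoidAlgebra k G)
    rw [← h1, LinearMap.rTensor_tmul] at h3
    have h4 := congrArg (TensorProduct.lid k _) h3
    rw [TensorProduct.lid_tmul, TensorProduct.lid_tmul, one_smul] at h4
    have h5 := congrArg (Coalgebra.counit (R := k)) h4
    rw [map_smul, smul_eq_mul] at h5
    have h6 : IsUnit (Coalgebra.counit (R := k) (a : MonoidAlgebra k G)) :=
      a.isUnit.map (Bialgebra.counitAlgHom k (MonoidAlgebra k G))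
    exact h6.mul_right_cancel (by rw [h5, one_mul])
  obtain ⟨g, hg⟩ := MonoidAlgebra.isGroupLikeElem_iff_mem_range_of.mp h2
  exact ⟨g, Units.ext hg.symm⟩

theorem exists_eq_mul_of_delta1_mem_TwistB2 {a : (MonoidAlgebra k G)ˣ}
    (ha : delta1 a ∈ TwistB2 k (MonoidAlgebra k G)) :
    ∃ g c, a = c * unitOf g ∧ ∀ h, Commute c (unitOf h) := by
  obtain ⟨c, hc, e⟩ := ha
  have hc' (b) : Commute c b := Units.ext (hc b)
  have h1 := delta1_mul_of_mem (a * c⁻¹) (delta1_mem_TwistA2 (k := k) hc)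
  rw [inv_mul_cancel_right, e, right_eq_mul] at h1
  obtain ⟨g, hg⟩ := exists_eq_of_delta1_eq_one h1
  exact ⟨g, c, by rw [← hg, (hc' _).eq, inv_mul_cancel_right], fun h => hc' _⟩

end Twist

/-! ### Lazy cohomology of the function algebra -/

section Lazy

variable {k : Type u} [Field k]

theorem pull_apply' {C D : Type*} [AddCommMonoid C] [Module k C] [Coalgebra k C] [AddCommMonoid D]
    [Module k D] [Coalgebra k D] (f : C →ₗc[k] D) (l : Reg k D) (x : C) :
    (pull f l : WithConv (C →ₗ[k] k)).ofConv x = (l : WithConv (D →ₗ[k] k)).ofConv (f x) := rfl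

theorem sum_counit_mul {C : Type*} [AddCommMonoid C] [Module k C] [Coalgebra k C]
    (l : C →ₗ[k] k) {x : C} {ι : Type*} (r : Coalgebra.Repr k x ι) :
    ∑ i ∈ r.index, Coalgebra.counit (R := k) (r.left i) * l (r.right i) = l x := by
  conv_rhs => rw [← Coalgebra.sum_counit_smul r]
  simp

theorem sum_mul_counit {C : Type*} [AddCommMonoid C] [Module k C] [Coalgebra k C]
    (l : C →ₗ[k] k) {x : C} {ι : Type*} (r : Coalgebra.Repr k x ι) :
    ∑ i ∈ r.index, Coalgebra.counit (R := k) (r.right i) * l (r.left i) = l x := by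
  conv_rhs => rw [← sum_smul_counit r]
  simp

section Tensor

variable {C D : Type*} [AddCommMonoid C] [Module k C] [Coalgebra k C]
  [AddCommMonoid D] [Module k D] [Coalgebra k D]

theorem pull_pr₁_mul_pull_pr₂_apply (a : Reg k C) (b : Reg k D) (x : C) (y : D) :
    ((pull pr₁ a * pull pr₂ b : Reg k (C ⊗[k] D)) : WithConv (C ⊗[k] D →ₗ[k] k)).ofConv (x ⊗ₜ y) =
      (a : WithConv (C →ₗ[k] k)).ofConv x * (b : WithConv (D →ₗ[k] k)).ofConv y := by
  have r := Coalgebra.Repr.arbitrary k x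
  have s := Coalgebra.Repr.arbitrary k y
  rw [Units.val_mul]
  refine ((tmulRepr r s).convMul_apply _ _).trans ?_
  rw [← sum_mul_counit _ r, ← sum_counit_mul _ s, Finset.sum_mul_sum]
  refine (Finset.sum_product _ _ _).trans ?_
  refine Finset.sum_congr rfl fun i _ => Finset.sum_congr rfl fun j _ => ?_
  simp [pull_apply, tmulRepr]
  ring

theorem pull_pr₂_mul_pull_pr₁_apply (a : Reg k C) (b : Reg k D) (x : C) (y : D) :
    ((pull pr₂ b * pull pr₁ a : Reg k (C ⊗[k] D)) : WithConv (C ⊗[k] D →ₗ[k] k)).ofConv (x ⊗ₜ y) =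
      (a : WithConv (C →ₗ[k] k)).ofConv x * (b : WithConv (D →ₗ[k] k)).ofConv y := by
  have r := Coalgebra.Repr.arbitrary k x
  have s := Coalgebra.Repr.arbitrary k y
  rw [Units.val_mul]
  refine ((tmulRepr r s).convMul_apply _ _).trans ?_
  rw [← sum_counit_mul _ r, ← sum_mul_counit _ s, Finset.sum_mul_sum]
  refine (Finset.sum_product _ _ _).trans ?_
  refine Finset.sum_congr rfl fun i _ => Finset.sum_congr rfl fun j _ => ?_
  simp [pull_apply, tmulRepr]
  ring

theorem pull_pr₁_commute_pull_pr₂ (a : Reg k C) (b : Reg k D) :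
    Commute (pull (pr₁ : C ⊗[k] D →ₗc[k] C) a) (pull pr₂ b) := by
  apply Units.ext
  apply WithConv.ext
  refine TensorProduct.ext' fun x y => ?_
  rw [pull_pr₁_mul_pull_pr₂_apply, pull_pr₂_mul_pull_pr₁_apply]

end Tensor

section Hopf

variable {H : Type v} [Ring H] [HopfAlgebra k H]

/-- `∂` is multiplicative as soon as `∂b` is lazy; neither `a` nor `b` needs to be. -/
theorem coboundary_mul_of_mem (a : Reg k H) {b : Reg k H} (hb : coboundary b ∈ RegLazy2 k H) :
    coboundary (a * b) = coboundary a * coboundary b := by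
  have h1 : Commute (coboundary b) (pull (mulC k H) a⁻¹) :=
    commute_pull_of_lazyWith (g := mulC k H) hb a⁻¹
  have h2 := pull_pr₁_commute_pull_pr₂ b a
  conv_rhs => rw [coboundary, mul_assoc, ← h1.eq]
  simp only [coboundary, mul_inv_rev, map_mul, mul_assoc]
  rw [h2.left_comm]

theorem mul_rearrange_of_commute {G : Type*} [Group G] {a b c m n : G}
    (h : Commute a (b * c * m⁻¹)) :
    b * c * m⁻¹ * (a * m * n⁻¹) = a * b * c * n⁻¹ := by
  rw [← mul_assoc, ← mul_assoc, ← h.eq]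
  group

/-- For every `l`, lazy or not, `∂l` satisfies the cocycle condition. -/
theorem cocycleL_coboundary_eq_cocycleR (l : Reg k H) :
    cocycleL (coboundary l) = cocycleR (coboundary l) := by
  have h1 : pull (Coalgebra.TensorProduct.map (CoalgHom.id k H) (mulC k H))
      (pull (pr₁ : H ⊗[k] H →ₗc[k] H) l) = pull (pr₁ : H ⊗[k] (H ⊗[k] H) →ₗc[k] H) l := by
    rw [pull_pull]
    exact pull_congr' (fun x y z => by simp [mul_comm]) l
  have h2 : pull (Coalgebra.TensorProduct.map (CoalgHom.id k H) (mulC k H))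
      (pull (pr₂ : H ⊗[k] H →ₗc[k] H) l) =
      pull (pr₂ : H ⊗[k] (H ⊗[k] H) →ₗc[k] H ⊗[k] H) (pull (mulC k H) l) := by
    rw [pull_pull, pull_pull]
    exact pull_congr' (fun x y z => by simp) l
  have e1 : pull q₁ l = pull (Coalgebra.TensorProduct.assoc k k H H H).toCoalgHom
      (pull (pr₁ : H ⊗[k] (H ⊗[k] H) →ₗc[k] H) l) := by
    rw [pull_pull]
    exact pull_congr (fun x y z => by simp [q₁, mul_smul]) l
  have e2 : pull q₂ l = pull (Coalgebra.TensorProduct.assoc k k H H H).toCoalgHom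
      (pull (pr₂ : H ⊗[k] (H ⊗[k] H) →ₗc[k] H ⊗[k] H) (pull (pr₁ : H ⊗[k] H →ₗc[k] H) l)) := by
    rw [pull_pull, pull_pull]
    exact pull_congr (fun x y z => by simp [q₂, smul_smul, mul_comm]) l
  have e3 : pull q₃ l = pull (Coalgebra.TensorProduct.assoc k k H H H).toCoalgHom
      (pull (pr₂ : H ⊗[k] (H ⊗[k] H) →ₗc[k] H ⊗[k] H) (pull (pr₂ : H ⊗[k] H →ₗc[k] H) l)) := by
    rw [pull_pull, pull_pull]
    exact pull_congr (fun x y z => by simp [q₃, smul_smul, mul_comm]) l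
  have e4 : pull mul₃ l = pull (Coalgebra.TensorProduct.assoc k k H H H).toCoalgHom
      (pull (Coalgebra.TensorProduct.map (CoalgHom.id k H) (mulC k H)) (pull (mulC k H) l)) := by
    rw [pull_pull, pull_pull]
    exact pull_congr (fun x y z => by simp [mul₃, mul_assoc]) l
  rw [cocycleL_coboundary, e1, e2, e3, e4]
  unfold cocycleR coboundary
  simp only [← map_mul, ← map_inv]
  congr 1
  simp only [map_mul, map_inv]
  rw [h1, h2]
  refine (mul_rearrange_of_commute ?_).symm
  simp only [← map_mul, ← map_inv]
  exact pull_pr₁_commute_pull_pr₂ _ _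

end Hopf

variable {G : Type w} [Group G] [Fintype G]

theorem ev_mul (g h : G) :
    (toConv (ev k (g * h)).toLinearMap : WithConv (FunctionAlgebra k G →ₗ[k] k)) =
    toConv (ev k g).toLinearMap * toConv (ev k h).toLinearMap := by
  classical
  apply WithConv.ext
  apply hom_ext
  intro x
  change _ = LinearMap.mul' k k (TensorProduct.map _ _ (Coalgebra.comul (R := k) (charFun k x)))
  rw [comul_charFun]
  simp [ev_charFun, eq_inv_mul_iff_mul_eq]
  rw [Finset.sum_eq_single g] <;> simp +contextual [eq_comm]

variable (k G) in
/-- `g ↦ ev_g`, as a homomorphism from `G` to the dual algebra of `O_k(G)`. -/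
noncomputable def evHom : G →* WithConv (FunctionAlgebra k G →ₗ[k] k) where
  toFun g := toConv (ev k g).toLinearMap
  map_one' := rfl
  map_mul' := ev_mul

/-- The embedding `g ↦ ev_g` of `G` into `Reg(O_k(G))`. -/
noncomputable def regOf : G →* Reg k (FunctionAlgebra k G) := (evHom k G).toHomUnits

theorem regOf_apply (g : G) (f : FunctionAlgebra k G) :
    ((regOf g : Reg k (FunctionAlgebra k G)) : WithConv (FunctionAlgebra k G →ₗ[k] k)).ofConv f =
      ev k g f := rfl

theorem regOf_injective : Function.Injective (regOf : G →* Reg k (FunctionAlgebra k G)) := by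
  classical
  intro g h e
  have := congrArg (fun l : Reg k (FunctionAlgebra k G) =>
    (l : WithConv (FunctionAlgebra k G →ₗ[k] k)).ofConv (charFun k h)) e
  simpa [regOf_apply, ev_charFun] using this

theorem pull_mulC_regOf (g : G) : pull (mulC k (FunctionAlgebra k G)) (regOf g) =
    pull pr₁ (regOf g) * pull pr₂ (regOf g) := by
  apply Units.ext
  apply WithConv.ext
  refine TensorProduct.ext' fun x y => ?_
  rw [pull_pr₁_mul_pull_pr₂_apply, pull_apply', regOf_apply, regOf_apply, regOf_apply, ← map_mul]
  rfl

/-- A form is lazy as soon as it commutes with the points of `G`, since these separate the elements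
of `O_k(G)`. -/
theorem mem_RegLazy2_of_commute {s : Reg k (FunctionAlgebra k G ⊗[k] FunctionAlgebra k G)}
    (hs : ∀ g : G, Commute s (pull (mulC k (FunctionAlgebra k G)) (regOf g))) :
    s ∈ RegLazy2 k (FunctionAlgebra k G) := by
  refine (mem_lazyWith_iff _ _).mpr fun x => ev_ext fun g => ?_
  have h (a b) := LinearMap.congr_fun (LinearMap.algHom_comp_convMul_distrib
    (C := FunctionAlgebra k G ⊗[k] FunctionAlgebra k G) (ev k g) a b) x
  refine (h _ _).trans (Eq.trans ?_ (h _ _).symm)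
  exact congrArg (fun l => (Units.val l).ofConv x) (hs g)

/-- The group-theoretic core of `coboundary_mem_LazyZ2`: there `P`, `Q`, `M` are the pullbacks along
the two projections and the multiplication, and `r`, `s` are points of `G`, so that `M r = P r * Q r`
and `M s = P s * Q s`. -/
theorem commute_of_mul_eq {U X : Type*} [Group U] [Group X] {P Q M : U →* X}
    (hPQ : ∀ a b, Commute (P a) (Q b)) {a r s : U} (h : a * r = s * a) (hr : M r = P r * Q r)
    (hs : M s = P s * Q s) : Commute (P a * Q a * M a⁻¹) (M s) := by
  have hinv : a⁻¹ * s = r * a⁻¹ := by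
    rw [inv_mul_eq_iff_eq_mul, ← mul_assoc, h, mul_inv_cancel_right]
  calc P a * Q a * M a⁻¹ * M s = P a * Q a * (P r * Q r) * M a⁻¹ := by
        rw [mul_assoc, ← map_mul, hinv, map_mul, hr, ← mul_assoc]
    _ = P (a * r) * Q (a * r) * M a⁻¹ := by
        rw [mul_mul_mul_swap (hPQ r a).eq.symm, map_mul, map_mul]
    _ = M s * (P a * Q a * M a⁻¹) := by
        rw [h, map_mul, map_mul, mul_mul_mul_swap (hPQ a s).eq, hs]
        simp only [mul_assoc]

/-- If conjugation with `a` permutes the points of `G`, then `∂a` is a lazy cocycle, although `a` need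
not be lazy. -/
theorem coboundary_mem_LazyZ2 {a : Reg k (FunctionAlgebra k G)} {φ : MulAut G}
    (ha : ∀ g, a * regOf g = regOf (φ g) * a) :
    coboundary a ∈ LazyZ2 k (FunctionAlgebra k G) := by
  refine ⟨mem_RegLazy2_of_commute fun g => ?_, cocycleL_coboundary_eq_cocycleR a⟩
  obtain ⟨g, rfl⟩ := φ.surjective g
  exact commute_of_mul_eq pull_pr₁_commute_pull_pr₂ (ha g) (pull_mulC_regOf g)
    (pull_mulC_regOf (φ g))

/-- If `∂a = 1`, then `a` is multiplicative, hence the evaluation at a point. -/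
theorem exists_eq_of_coboundary_eq_one {a : Reg k (FunctionAlgebra k G)}
    (ha : coboundary a = 1) : ∃ g, a = regOf g := by
  rw [coboundary, map_inv, mul_inv_eq_one] at ha
  let m := (a : WithConv (FunctionAlgebra k G →ₗ[k] k)).ofConv
  have hm (x y : FunctionAlgebra k G) : m x * m y = m (x * y) := by
    have := congrArg (fun l => (Units.val l).ofConv (x ⊗ₜ[k] y)) ha
    simp only [pull_pr₁_mul_pull_pr₂_apply] at this
    exact this
  obtain ⟨g, hg⟩ : ∃ g, m (charFun k g) ≠ 0 := by
    by_contra! h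
    have h0 : m = 0 := hom_ext h
    have h1 := a.mul_inv
    rw [show (a : WithConv (FunctionAlgebra k G →ₗ[k] k)) = 0 from WithConv.ext h0, zero_mul] at h1
    have h2 := congrArg (fun l : WithConv (FunctionAlgebra k G →ₗ[k] k) => l.ofConv 1) h1
    simp [LinearMap.convOne_def] at h2
  refine ⟨g, Units.ext (WithConv.ext (LinearMap.ext fun f => mul_right_cancel₀ hg ?_))⟩
  have e : f * charFun k g = ev k g f • charFun k g := by
    classical
    apply ev_ext
    intro x
    rw [map_mul, map_smul, ev_charFun]
    split_ifs with h <;> simp [h]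
  change m f * _ = ev k g f * _
  rw [hm, e, map_smul, smul_eq_mul]

/-- The only elements `a` for which `∂a` is a lazy coboundary are the products of points of `G` and
lazy forms. -/
theorem exists_eq_mul_of_coboundary_mem_LazyB2 {a : Reg k (FunctionAlgebra k G)}
    (ha : coboundary a ∈ LazyB2 k (FunctionAlgebra k G)) :
    ∃ g c, a = c * regOf g ∧ ∀ h, Commute c (regOf h) := by
  obtain ⟨c, hc, e⟩ := ha
  have h1 := coboundary_mul_of_mem (a * c⁻¹) (coboundary_mem_RegLazy2 hc)
  rw [inv_mul_cancel_right, e, right_eq_mul] at h1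
  obtain ⟨g, hg⟩ := exists_eq_of_coboundary_eq_one h1
  exact ⟨g, c, by rw [← hg, (central_of_lazy hc _).eq, inv_mul_cancel_right],
    fun h => central_of_lazy hc _⟩

end Lazy

/-! ### The group of order `q⁵` -/

/-- Let `Q` be the group of matrices `[[1, x, z], [0, 1, σ x], [0, 0, 1]]` over `F`. A tuple
`(x, z, u, v, w)` stands for the element of `F³ ⋊ Q` whose `Q`-part is given by `x`, `z` and whose
vector part is the column `(w, v, u)`. -/
@[ext] structure SahGroup {F : Type w} [Field F] (σ : F ≃+* F) where
  /-- The superdiagonal entry of the matrix part. -/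
  x : F
  /-- The corner entry of the matrix part. -/
  z : F
  /-- The bottom entry of the vector part. -/
  u : F
  /-- The middle entry of the vector part. -/
  v : F
  /-- The top entry of the vector part. -/
  w : F

namespace SahGroup

variable {F : Type w} [Field F] {σ : F ≃+* F}

instance : Mul (SahGroup σ) where
  mul g h := ⟨g.x + h.x, g.z + h.z + g.x * σ h.x, g.u + h.u, g.v + h.v + σ g.x * h.u,
    g.w + h.w + g.x * h.v + g.z * h.u⟩

instance : One (SahGroup σ) where
  one := ⟨0, 0, 0, 0, 0⟩

instance : Inv (SahGroup σ) where
  inv g := ⟨-g.x, -g.z + g.x * σ g.x, -g.u, -g.v + σ g.x * g.u,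
    -g.w + g.x * g.v + g.z * g.u - g.x * σ g.x * g.u⟩

theorem mul_def (g h : SahGroup σ) : g * h =
    ⟨g.x + h.x, g.z + h.z + g.x * σ h.x, g.u + h.u, g.v + h.v + σ g.x * h.u,
      g.w + h.w + g.x * h.v + g.z * h.u⟩ := rfl

theorem one_def : (1 : SahGroup σ) = ⟨0, 0, 0, 0, 0⟩ := rfl

theorem inv_def (g : SahGroup σ) : g⁻¹ = ⟨-g.x, -g.z + g.x * σ g.x, -g.u, -g.v + σ g.x * g.u,
    -g.w + g.x * g.v + g.z * g.u - g.x * σ g.x * g.u⟩ := rfl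

instance : Group (SahGroup σ) :=
  Group.ofLeftAxioms
    (fun a b c => by ext <;> simp only [mul_def, map_add] <;> ring)
    (fun a => by ext <;> simp [mul_def, one_def])
    (fun a => by ext <;> simp only [mul_def, one_def, inv_def, map_neg] <;> ring)

variable (σ) in
/-- The underlying set of `SahGroup σ` is `F⁵`. -/
def equivProd : SahGroup σ ≃ F × F × F × F × F where
  toFun g := (g.x, g.z, g.u, g.v, g.w)
  invFun t := ⟨t.1, t.2.1, t.2.2.1, t.2.2.2.1, t.2.2.2.2⟩
  left_inv _ := rfl
  right_inv _ := rfl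

noncomputable instance [Finite F] : Fintype (SahGroup σ) :=
  haveI := Fintype.ofFinite F
  Fintype.ofEquiv _ (equivProd σ).symm

theorem card_eq [Finite F] : Fintype.card (SahGroup σ) = Nat.card F ^ 5 := by
  rw [← Nat.card_eq_fintype_card, Nat.card_congr (equivProd σ)]
  simp only [Nat.card_prod]
  ring

variable (σ) in
/-- The automorphism that is the identity on `Q` and acts on the vector part by
`(w, v, u) ↦ (w + σ⁻¹ v, v + σ⁻¹ u, u)`, which commutes with the action of `Q`. -/
def vecAut : MulAut (SahGroup σ) where
  toFun g := ⟨g.x, g.z, g.u, g.v + σ.symm g.u, g.w + σ.symm g.v⟩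
  invFun g := ⟨g.x, g.z, g.u, g.v - σ.symm g.u, g.w - σ.symm (g.v - σ.symm g.u)⟩
  left_inv g := by simp
  right_inv g := by simp
  map_mul' g h := by
    ext <;> simp only [mul_def, map_add, map_mul, RingEquiv.symm_apply_apply] <;> ring

variable (σ) in
/-- The automorphism that is the identity on the vector part `F³` and multiplies an element of `Q`
by the value of the 1-cocycle `(x, z) ↦ (x σ⁻¹x - σ⁻¹z, σ⁻¹x, 0)` from `Q` to `F³`. -/
def derAut : MulAut (SahGroup σ) where
  toFun g := ⟨g.x, g.z, g.u, g.v + σ.symm g.x, g.w + g.x * σ.symm g.x - σ.symm g.z⟩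
  invFun g := ⟨g.x, g.z, g.u, g.v - σ.symm g.x, g.w - g.x * σ.symm g.x + σ.symm g.z⟩
  left_inv g := by
    ext <;> simp
    ring
  right_inv g := by
    ext <;> simp
    ring
  map_mul' g h := by
    ext <;> simp only [mul_def, map_add, map_mul, RingEquiv.symm_apply_apply] <;> ring

theorem isConj_of_mul_eq {G : Type*} [Group G] {a b h : G} (e : h * a = b * h) : IsConj a b :=
  isConj_iff.mpr ⟨h, by rw [e, mul_inv_cancel_right]⟩

theorem isConj_of_x_ne_zero {x : F} (hx : x ≠ 0) (z u v w v' w' : F) :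
    IsConj (⟨x, z, u, v, w⟩ : SahGroup σ) ⟨x, z, u, v', w'⟩ := by
  have hx' : σ x ≠ 0 := by simpa using hx
  apply isConj_of_mul_eq
    (h := ⟨0, 0, (v - v') / σ x, 0, 0⟩ * ⟨0, 0, 0, (w - w' - z * ((v - v') / σ x)) / x, 0⟩)
  ext <;> simp [mul_def] <;> field_simp <;> ring

theorem isConj_of_z_ne_zero {z : F} (hz : z ≠ 0) (u v w w' : F) :
    IsConj (⟨0, z, u, v, w⟩ : SahGroup σ) ⟨0, z, u, v, w'⟩ := by
  apply isConj_of_mul_eq (h := ⟨0, 0, (w - w') / z, 0, 0⟩)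
  ext <;> simp [mul_def]
  all_goals field_simp
  all_goals ring

theorem isConj_of_u_ne_zero {u : F} (hu : u ≠ 0) (z v w v' w' : F) :
    IsConj (⟨0, z, u, v, w⟩ : SahGroup σ) ⟨0, z, u, v', w'⟩ := by
  apply isConj_of_mul_eq (h := ⟨σ.symm ((v' - v) / u),
    (w' - w - σ.symm ((v' - v) / u) * v) / u, 0, 0, 0⟩)
  ext <;> simp [mul_def, -map_div₀, -map_sub] <;> field_simp <;> ring

theorem isConj_of_v_ne_zero {v : F} (hv : v ≠ 0) (z w w' : F) :
    IsConj (⟨0, z, 0, v, w⟩ : SahGroup σ) ⟨0, z, 0, v, w'⟩ := by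
  apply isConj_of_mul_eq (h := ⟨(w' - w) / v, 0, 0, 0, 0⟩)
  ext <;> simp [mul_def]
  all_goals field_simp
  all_goals ring

/-- The changes that `vecAut σ` makes in `v` and `w` can also be made by conjugation, in a way that
depends on the first non-zero entry among `x`, `u`, `v`. -/
theorem vecAut_mem : vecAut σ ∈ AutC (SahGroup σ) := by
  rintro ⟨x, z, u, v, w⟩
  by_cases hx : x = 0
  · subst hx
    by_cases hu : u = 0
    · subst hu
      by_cases hv : v = 0
      · subst hv
        simp only [vecAut, MulEquiv.coe_mk, Equiv.coe_fn_mk, map_zero, add_zero]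
        exact IsConj.refl _
      · simpa [vecAut] using isConj_of_v_ne_zero hv _ _ _
    · exact isConj_of_u_ne_zero hu _ _ _ _ _
  · exact isConj_of_x_ne_zero hx _ _ _ _ _ _

theorem derAut_mem : derAut σ ∈ AutC (SahGroup σ) := by
  rintro ⟨x, z, u, v, w⟩
  by_cases hx : x = 0
  · subst hx
    by_cases hz : z = 0
    · subst hz
      simp only [derAut, MulEquiv.coe_mk, Equiv.coe_fn_mk, map_zero, add_zero, zero_mul, sub_zero]
      exact IsConj.refl _
    · simpa [derAut] using isConj_of_z_ne_zero hz _ _ _ _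
  · exact isConj_of_x_ne_zero hx _ _ _ _ _ _

/-- The commutator of `vecAut σ` and `derAut σ` adds `σ⁻² x` to the entry `w`, and an inner
automorphism of this form adds a constant multiple of `x`. -/
theorem outC_noncomm (hσ : ∃ a, σ (σ a) ≠ a) : ∃ a b : OutC (SahGroup σ), a * b ≠ b * a := by
  obtain ⟨a, ha⟩ := hσ
  refine ⟨QuotientGroup.mk ⟨_, vecAut_mem⟩, QuotientGroup.mk ⟨_, derAut_mem⟩, fun h => ha ?_⟩
  rw [← QuotientGroup.mk_mul, ← QuotientGroup.mk_mul, eq_comm, QuotientGroup.eq] at h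
  obtain ⟨c, hc⟩ : (derAut σ * vecAut σ)⁻¹ * (vecAut σ * derAut σ) ∈ InnerAut (SahGroup σ) := h
  have key (g : SahGroup σ) : vecAut σ (derAut σ g) = derAut σ (vecAut σ (c * g * c⁻¹)) := by
    have := DFunLike.congr_fun (eq_inv_mul_iff_mul_eq.mp hc) g
    simpa [MulAut.conj_apply] using this.symm
  have key' (g : SahGroup σ) :
      (⟨g.x, g.z, g.u, g.v, g.w + σ.symm (σ.symm g.x)⟩ : SahGroup σ) * c = c * g := by
    rw [← eq_mul_inv_iff_mul_eq]
    apply (vecAut σ).injective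
    apply (derAut σ).injective
    rw [← key]
    ext <;> simp [vecAut, derAut] <;> ring
  have h0 (y : F) : σ.symm (σ.symm y) + y * c.v = 0 := by
    have := congrArg SahGroup.w (key' ⟨y, 0, 0, 0, 0⟩)
    simp [mul_def] at this
    linear_combination this
  have h1 := h0 1
  have h2 := h0 (σ (σ a))
  simp at h1 h2
  have : c.v = -1 := by linear_combination h1
  rw [this] at h2
  linear_combination -h2

end SahGroup

theorem exists_frobenius_sq_ne {p m : ℕ} [Fact p.Prime] (hm : 3 ≤ m) :
    ∃ a : GaloisField p m, frobeniusEquiv (GaloisField p m) p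
      (frobeniusEquiv (GaloisField p m) p a) ≠ a := by
  by_contra! h
  have hp := (Fact.out : p.Prime)
  obtain ⟨g, hg⟩ := IsCyclic.exists_generator (α := (GaloisField p m)ˣ)
  have h1 := h g
  rw [frobeniusEquiv_apply, frobeniusEquiv_apply, frobenius_def, frobenius_def, ← pow_mul] at h1
  have h2 : g ^ (p * p) = g ^ 1 := Units.ext (by simpa using h1)
  have hc : orderOf g = p ^ m - 1 := by
    rw [orderOf_eq_card_of_forall_mem_zpowers hg, Nat.card_units, GaloisField.card p m (by omega)]
  rw [pow_eq_pow_iff_modEq, hc] at h2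
  have h4 : p * p * p ≤ p ^ m := by
    calc p * p * p = p ^ 3 := by ring
      _ ≤ p ^ m := Nat.pow_le_pow_right hp.pos hm
  have h5 := hp.two_le
  have h6 := Nat.sub_add_cancel (show 1 ≤ p ^ m by nlinarith)
  have h3 := Nat.ModEq.eq_of_lt_of_lt h2 (by nlinarith) (by nlinarith)
  nlinarith

/-! ### Non-abelian cohomology groups -/

section Implementation

variable {k : Type u} [Field k] [IsAlgClosed k] {G : Type w} [Group G] [Fintype G]

theorem exists_unitOf_of_mem_AutC (hG : (Nat.card G : k) ≠ 0) {φ : MulAut G} (hφ : φ ∈ AutC G) :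
    ∃ a : (MonoidAlgebra k G)ˣ, ∀ g, a * unitOf g = unitOf (φ g) * a := by
  obtain ⟨a, ha⟩ := exists_unit_of_mem_AutC hG hφ
  exact ⟨a, fun g => Units.ext (ha g)⟩

/-- The homomorphism `k[G] → O_k(G)*` that is the identity on `G` carries the elements of `k[G]` that
implement an automorphism to the dual of `O_k(G)`. -/
theorem exists_regOf_of_mem_AutC (hG : (Nat.card G : k) ≠ 0) {φ : MulAut G} (hφ : φ ∈ AutC G) :
    ∃ a : Reg k (FunctionAlgebra k G), ∀ g, a * regOf g = regOf (φ g) * a := by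
  obtain ⟨a, ha⟩ := exists_unit_of_mem_AutC hG hφ
  let ρ := MonoidAlgebra.lift k (WithConv (FunctionAlgebra k G →ₗ[k] k)) G (evHom k G)
  refine ⟨Units.map ρ.toMonoidHom a, fun g => Units.ext ?_⟩
  have h := congrArg ρ (ha g)
  rw [map_mul, map_mul, MonoidAlgebra.lift_of, MonoidAlgebra.lift_of] at h
  exact h

theorem twistH2_noncomm (hG : (Nat.card G : k) ≠ 0) (h : ∃ a b : OutC G, a * b ≠ b * a) :
    ∃ a b : TwistH2 k (MonoidAlgebra k G), a * b ≠ b * a :=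
  exists_noncomm_of_outC unitOf_injective (fun _ hφ => exists_unitOf_of_mem_AutC hG hφ) delta1 _ _
    (fun _ _ ha => delta1_mem_TwistZ2 ha)
    (fun a _ _ hb => delta1_mul_of_mem a (delta1_mem_TwistZ2 hb).1)
    (fun _ ha => exists_eq_mul_of_delta1_mem_TwistB2 ha) h

theorem lazyH2_noncomm (hG : (Nat.card G : k) ≠ 0) (h : ∃ a b : OutC G, a * b ≠ b * a) :
    ∃ a b : LazyH2 k (FunctionAlgebra k G), a * b ≠ b * a :=
  exists_noncomm_of_outC regOf_injective (fun _ hφ => exists_regOf_of_mem_AutC hG hφ) coboundary _ _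
    (fun _ _ ha => coboundary_mem_LazyZ2 ha)
    (fun a _ _ hb => coboundary_mul_of_mem a (coboundary_mem_LazyZ2 hb).1)
    (fun _ ha => exists_eq_mul_of_coboundary_mem_LazyB2 ha) h

end Implementation
end LazyCoh

theorem mainTheorem3 (p : ℕ) (hp : p.Prime) (m : ℕ) (hm : 3 ≤ m) :
    ∃ (G : Type) (_ : Group G) (_ : Fintype G),
      Fintype.card G = p ^ (5 * m) ∧
      (∃ a b : LazyCoh.OutC G, a * b ≠ b * a) ∧
      ∀ (k : Type u) [Field k] [IsAlgClosed k], (p : k) ≠ 0 →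
        FiniteDimensional k (LazyCoh.FunctionAlgebra k G) ∧
        (∃ a b : LazyCoh.LazyH2 k (LazyCoh.FunctionAlgebra k G), a * b ≠ b * a) ∧
        (∃ a b : LazyCoh.TwistH2 k (MonoidAlgebra k G), a * b ≠ b * a) := by
  have : Fact p.Prime := ⟨hp⟩
  let σ : GaloisField p m ≃+* GaloisField p m := frobeniusEquiv (GaloisField p m) p
  have hcard : Fintype.card (LazyCoh.SahGroup σ) = p ^ (5 * m) := by
    rw [LazyCoh.SahGroup.card_eq, GaloisField.card p m (by omega), ← pow_mul, mul_comm]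
  have hout : ∃ a b : LazyCoh.OutC (LazyCoh.SahGroup σ), a * b ≠ b * a :=
    LazyCoh.SahGroup.outC_noncomm (LazyCoh.exists_frobenius_sq_ne hm)
  refine ⟨LazyCoh.SahGroup σ, inferInstance, inferInstance, hcard, hout, fun k _ _ hk => ?_⟩
  have hG : (Nat.card (LazyCoh.SahGroup σ) : k) ≠ 0 := by
    rw [Nat.card_eq_fintype_card, hcard, Nat.cast_pow]
    exact pow_ne_zero _ hk
  exact ⟨inferInstance, LazyCoh.lazyH2_noncomm hG hout, LazyCoh.twistH2_noncomm hG hout⟩
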